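/- **Setting.** A base station (BS) sits at the origin of the plane. Near users form a homogeneous Poisson point process $\Phi_n$ of density $\lambda_n>0$ on the disc of radius $R_1>0$; far users form an independent homogeneous Poisson point process $\Phi_f$ of density $\lambda_f>0$ on the ring with radii $R_2<R_3$, $R_1<R_2$. The users $U_1\in\Phi_n$ and $U_2\in\Phi_f$ nearest to the BS are selected (nearest near / nearest far user, NNNF). Of $K\ge 1$ relays equally spaced on the circle of radius $R_1$, the relay $\mathbb R$ closest to $U_2$ is selected (if $\Phi_f=\emptyset$, $U_2$ is an arbitrary point); it has $N_R\ge1$ receive and $N_T\ge2$ transmit antennas. The channels $h_1\in\mathbb C$ (BS to $U_1$), $f_1\in\mathbb C^{N_T}$ (residual interference from $\mathbb R$ to $U_1$), $h_R\in\mathbb C^{N_R}$ (BS to $\mathbb R$), $H_{RR}\in\mathbb C^{N_R\times N_T}$ (residual self-interference) and $f_2\in\mathbb C^{N_T}$ ($\mathbb R$ to $U_2$) have i.i.d. entries with laws $\mathcal{CN}(0,1)$, $\mathcal{CN}(0,q_r)$, $\mathcal{CN}(0,1)$, $\mathcal{CN}(0,\sigma_{RR}^2)$, $\mathcal{CN}(0,1)$,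 where $q_r\ge0$ and $\sigma_{RR}^2>0$; $\Phi_n,\Phi_f,h_1,f_1,h_R,H_{RR},f_2$ are mutually independent. The relay uses the transmit zero-forcing (TZF) beamformer $$w=\frac{Bf_2^*}{\|Bf_2^*\|},\qquad B=I-\frac{H_{RR}^\dagger h_Rh_R^\dagger H_{RR}}{\|h_R^\dagger H_{RR}\|^2}.$$ Let $\alpha\ge2$ be the path-loss exponent, $\rho_s=P_S/\sigma^2>0$, $\rho_r=P_R/\sigma^2>0$, let $0<a_1<a_2$ with $a_1+a_2=1$ be the power allocation coefficients, and let $\tau_i=2^{\mathcal R_i}-1$ with rates $\mathcal R_i>0$. With $\ell=\|U_1\|$, $\ell_R=\|\mathbb R-U_1\|$, $I=\rho_r\ell_R^{-\alpha}|f_1^Tw|^2$, the SINRs of $U_1$ for the far user's and for its own symbol are $$\gamma^{x_2}=\frac{\rho_sa_2\ell^{-\alpha}|h_1|^2}{\rho_sa_1\ell^{-\alpha}|h_1|^2+I+1},\qquad \gamma^{x_1}=\frac{\rho_sa_1\ell^{-\alpha}|h_1|^2}{I+1},$$ and the outage probability of the selected near user is $P_{\rm out}=1-\Pr(\gamma^{x_2}>\tau_2,\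 \gamma^{x_1}>\tau_1\mid \Phi_n\ne\emptyset)$. **Statement.** Suppose $\tau_2<a_2/a_1$. Put $\zeta=\rho_s(a_2-a_1\tau_2)/\tau_2$, $\mu=\max\bigl(\tfrac1\zeta,\tfrac{\tau_1}{\rho_sa_1}\bigr)$, $\upsilon_n=\dfrac{2\pi\lambda_n}{1-e^{-\pi\lambda_nR_1^2}}$ and, for $\eta=\pm1$ (the value given to the cosine of the angle between $U_1$ and the relay), $$F_\eta(r)=1-\frac{e^{-\mu r^\alpha}}{1+q_r\rho_r\mu\, r^\alpha\,(R_1^2+r^2-2\eta R_1r)^{-\alpha/2}},\qquad P_\eta=\upsilon_n\int_0^{R_1}r\,e^{-\pi\lambda_nr^2}F_\eta(r)\,dr .$$ Then $P_{-1}\le P_{\rm out}\le P_{1}$. Moreover both bounds are approximated in closed form by Gauss–Chebyshev sums: for $\eta=\pm1$, $$P_\eta=\lim_{M\to\infty}\frac{\pi\upsilon_nR_1}{2M}\sum_{m=1}^{M}\sqrt{1-\phi_m^2}\;F_\eta(c_m)\,c_m\,e^{-\pi\lambda_nc_m^2},\qquad \phi_m=\cos\Bigl(\frac{2m-1}{2M}\pi\Bigr),\quad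 c_m=(\phi_m+1)\frac{R_1}{2}.$$ If $\tau_2\ge a_2/a_1$, then $P_{\rm out}=1$. -/

import Mathlib

open MeasureTheory ProbabilityTheory Matrix

noncomputable section

/-! ### Probabilistic building blocks -/

/-- The circularly symmetric complex Gaussian law `CN(0, v)`: independent real and imaginary
parts, each with law `N(0, v / 2)`. -/
def complexGaussian (v : ℝ) : Measure ℂ :=
  ((gaussianReal 0 (v / 2).toNNReal).prod (gaussianReal 0 (v / 2).toNNReal)).map
    Complex.measurableEquivRealProd.symm

/-- Number of points of the random finite set `Φ` that lie in `B`. -/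
def pointCount {Ω : Type*} (Φ : Ω → Set ℂ) (B : Set ℂ) (ω : Ω) : ℕ :=
  (Φ ω ∩ B).ncard

/-- The sigma-algebra generated by a point process, that is, by all its counts. -/
@[reducible] def pointSigma {Ω : Type*} (Φ : Ω → Set ℂ) : MeasurableSpace Ω :=
  ⨆ (B : Set ℂ) (_ : MeasurableSet B), MeasurableSpace.comap (pointCount Φ B) ⊤

/-- `Φ` is a homogeneous Poisson point process of density `lam` on the bounded planar region
`D`: counts are Poisson with mean `lam` times area, and counts in disjoint sets are independent. -/
structure IsPoissonPointProcess {Ω : Type*} [MeasurableSpace Ω] (P : Measure Ω)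
    (D : Set ℂ) (lam : ℝ) (Φ : Ω → Set ℂ) : Prop where
  subset_region : ∀ ω, Φ ω ⊆ D
  finite : ∀ ω, (Φ ω).Finite
  measurable_count : ∀ B, MeasurableSet B → Measurable (pointCount Φ B)
  law_count : ∀ B, MeasurableSet B →
    P.map (pointCount Φ B) = poissonMeasure (lam * volume.real (B ∩ D)).toNNReal
  indep_count : ∀ (n : ℕ) (B : Fin n → Set ℂ), (∀ i, MeasurableSet (B i)) →
    Pairwise (fun i j => Disjoint (B i) (B j)) →
    iIndepFun (fun i => pointCount Φ (B i)) P

/-- `x` is a point of `s` with the shortest distance to the base station (the origin). -/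
def IsNearestPoint (s : Set ℂ) (x : ℂ) : Prop :=
  x ∈ s ∧ ∀ y ∈ s, ‖x‖ ≤ ‖y‖

/-! ### Transmit zero-forcing beamforming -/

/-- The Euclidean norm of a complex vector. -/
def euclNorm {n : ℕ} (v : Fin n → ℂ) : ℝ :=
  ‖WithLp.toLp 2 v‖

/-- `B = I - Hᴴ h hᴴ H / ‖hᴴ H‖²`, the projection onto the vectors `w` with `hᴴ H w = 0`. -/
def zfProjection {NR NT : ℕ} (h : Fin NR → ℂ) (H : Matrix (Fin NR) (Fin NT) ℂ) :
    Matrix (Fin NT) (Fin NT) ℂ :=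
  1 - ((((euclNorm (star h ᵥ* H)) ^ 2)⁻¹ : ℝ) : ℂ) • (Hᴴ * vecMulVec h (star h) * H)

/-- The transmit zero-forcing beamformer `w = B f₂* / ‖B f₂*‖`. -/
def zfBeamformer {NR NT : ℕ} (h : Fin NR → ℂ) (H : Matrix (Fin NR) (Fin NT) ℂ)
    (f₂ : Fin NT → ℂ) : Fin NT → ℂ :=
  (((euclNorm (zfProjection h H *ᵥ star f₂))⁻¹ : ℝ) : ℂ) • (zfProjection h H *ᵥ star f₂)

/-! ### System parameters -/

/-- Deterministic parameters of the network. -/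
structure NomaParams where
  /-- radius of the near-user disc, also the distance from the base station to each relay -/
  R₁ : ℝ
  /-- inner radius of the far-user ring -/
  R₂ : ℝ
  /-- outer radius of the far-user ring -/
  R₃ : ℝ
  /-- density of near users -/
  lamN : ℝ
  /-- density of far users -/
  lamF : ℝ
  /-- path loss exponent -/
  α : ℝ
  /-- number of relays -/
  K : ℕ
  /-- angle of the first relay -/
  θ₀ : ℝ
  /-- number of receive antennas of the relay -/
  NR : ℕ
  /-- number of transmit antennas of the relay -/
  NT : ℕ
  /-- power allocation coefficient of the near user -/
  a₁ : ℝ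
  /-- power allocation coefficient of the far user -/
  a₂ : ℝ
  /-- transmit power of the base station -/
  PS : ℝ
  /-- transmit power of the relay -/
  PR : ℝ
  /-- mean noise power -/
  noise : ℝ
  /-- strength of the residual inter-user interference channel -/
  qr : ℝ
  /-- variance of the residual self-interference channel -/
  varRR : ℝ
  /-- transmission rate of the near user -/
  rate₁ : ℝ
  /-- transmission rate of the far user -/
  rate₂ : ℝ
  R₁_pos : 0 < R₁
  R₁_lt_R₂ : R₁ < R₂
  R₂_lt_R₃ : R₂ < R₃
  lamN_pos : 0 < lamN
  lamF_pos : 0 < lamF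
  two_le_α : 2 ≤ α
  K_pos : 0 < K
  NR_pos : 0 < NR
  one_lt_NT : 1 < NT
  a₁_pos : 0 < a₁
  a₁_lt_a₂ : a₁ < a₂
  a₁_add_a₂ : a₁ + a₂ = 1
  PS_pos : 0 < PS
  PR_pos : 0 < PR
  noise_pos : 0 < noise
  qr_nonneg : 0 ≤ qr
  varRR_pos : 0 < varRR
  rate₁_pos : 0 < rate₁
  rate₂_pos : 0 < rate₂

namespace NomaParams

variable (p : NomaParams)

/-- The disc of the near users. -/
def nearDisc : Set ℂ := {z | ‖z‖ ≤ p.R₁}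

/-- The ring of the far users. -/
def farRing : Set ℂ := {z | p.R₂ ≤ ‖z‖ ∧ ‖z‖ ≤ p.R₃}

/-- The relays, equally spaced on the circle of radius `R₁`. -/
def relayPos (k : Fin p.K) : ℂ :=
  p.R₁ * Complex.exp (((p.θ₀ + 2 * Real.pi * (k : ℕ) / p.K : ℝ) : ℂ) * Complex.I)

def ρs : ℝ := p.PS / p.noise

def ρr : ℝ := p.PR / p.noise

def τ₁ : ℝ := (2 : ℝ) ^ p.rate₁ - 1

def τ₂ : ℝ := (2 : ℝ) ^ p.rate₂ - 1

def ζ : ℝ := (p.ρs * p.a₂ - p.ρs * p.a₁ * p.τ₂) / p.τ₂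

def μ : ℝ := max (1 / p.ζ) (p.τ₁ / (p.ρs * p.a₁))

def υn : ℝ := 2 * Real.pi * p.lamN / (1 - Real.exp (-(Real.pi * p.lamN * p.R₁ ^ 2)))

/-- Outage probability of a near user at distance `r` from the base station, with the cosine of
the angle between this user and the relay set to `η`. -/
def outageAt (η r : ℝ) : ℝ :=
  1 - Real.exp (-(p.μ * r ^ p.α)) /
    (1 + p.qr * p.ρr * p.μ * r ^ p.α *
      (p.R₁ ^ 2 + r ^ 2 - 2 * η * p.R₁ * r) ^ (-p.α / 2))

/-- The near-user outage integral with the cosine set to `η`. -/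
def outageBound (η : ℝ) : ℝ :=
  p.υn * ∫ r in (0 : ℝ)..p.R₁,
    r * Real.exp (-(Real.pi * p.lamN * r ^ 2)) * p.outageAt η r

/-- The Chebyshev nodes `φ_m`. -/
def φ (M m : ℕ) : ℝ := Real.cos ((2 * m - 1) / (2 * M) * Real.pi)

/-- The abscissas `c_m`. -/
def c (M m : ℕ) : ℝ := (φ M m + 1) * (p.R₁ / 2)

/-- The closed-form Gauss-Chebyshev sum with `M` nodes. -/
def chebyshevSum (η : ℝ) (M : ℕ) : ℝ :=
  Real.pi * p.υn * p.R₁ / (2 * M) *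
    ∑ m ∈ Finset.Icc 1 M, √(1 - φ M m ^ 2) * p.outageAt η (p.c M m) *
      p.c M m * Real.exp (-(Real.pi * p.lamN * p.c M m ^ 2))

end NomaParams

/-! ### The random network under nearest near user / nearest far user selection -/

/-- Random locations, selected users, selected relay and fading channels. -/
structure NNNFNetwork {Ω : Type*} [MeasurableSpace Ω] (p : NomaParams) (P : Measure Ω) where
  /-- near users -/
  Φn : Ω → Set ℂ
  /-- far users -/
  Φf : Ω → Set ℂ
  /-- selected near user -/
  U₁ : Ω → ℂ
  /-- selected far user -/
  U₂ : Ω → ℂ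
  /-- index of the selected relay -/
  κ : Ω → Fin p.K
  /-- channel from the base station to the selected near user -/
  h₁ : Ω → ℂ
  /-- residual interference channel from the relay to the selected near user -/
  f₁ : Ω → Fin p.NT → ℂ
  /-- channel from the base station to the relay -/
  hR : Ω → Fin p.NR → ℂ
  /-- residual self-interference channel of the relay -/
  HRR : Ω → Fin p.NR → Fin p.NT → ℂ
  /-- channel from the relay to the selected far user -/
  f₂ : Ω → Fin p.NT → ℂ
  poisson_near : IsPoissonPointProcess P p.nearDisc p.lamN Φn
  poisson_far : IsPoissonPointProcess P p.farRing p.lamF Φf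
  measurable_U₁ : Measurable U₁
  measurable_U₂ : Measurable U₂
  measurable_κ : Measurable κ
  nearest_U₁ : ∀ ω, (Φn ω).Nonempty → IsNearestPoint (Φn ω) (U₁ ω)
  nearest_U₂ : ∀ ω, (Φf ω).Nonempty → IsNearestPoint (Φf ω) (U₂ ω)
  nearest_relay : ∀ ω k, ‖p.relayPos (κ ω) - U₂ ω‖ ≤ ‖p.relayPos k - U₂ ω‖
  measurable_h₁ : Measurable h₁
  measurable_f₁ : Measurable f₁
  measurable_hR : Measurable hR
  measurable_HRR : Measurable HRR
  measurable_f₂ : Measurable f₂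
  law_h₁ : P.map h₁ = complexGaussian 1
  law_f₁ : P.map f₁ = Measure.pi fun _ => complexGaussian p.qr
  law_hR : P.map hR = Measure.pi fun _ => complexGaussian 1
  law_HRR : P.map HRR = Measure.pi fun _ => Measure.pi fun _ => complexGaussian p.varRR
  law_f₂ : P.map f₂ = Measure.pi fun _ => complexGaussian 1
  /-- the two point processes and the five channels are mutually independent -/
  indep : iIndep ![pointSigma Φn, pointSigma Φf,
    MeasurableSpace.comap h₁ inferInstance, MeasurableSpace.comap f₁ inferInstance,
    MeasurableSpace.comap hR inferInstance, MeasurableSpace.comap HRR inferInstance,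
    MeasurableSpace.comap f₂ inferInstance] P

namespace NNNFNetwork

variable {Ω : Type*} [MeasurableSpace Ω] {p : NomaParams} {P : Measure Ω}
  (X : NNNFNetwork p P)

/-- Distance from the selected near user to the base station. -/
def dist₁ (ω : Ω) : ℝ := ‖X.U₁ ω‖

/-- Distance from the selected relay to the selected near user. -/
def distR (ω : Ω) : ℝ := ‖p.relayPos (X.κ ω) - X.U₁ ω‖

/-- The beamformer of the relay. -/
def w (ω : Ω) : Fin p.NT → ℂ := zfBeamformer (X.hR ω) (Matrix.of (X.HRR ω)) (X.f₂ ω)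

/-- Interference power received from the relay, relative to the noise. -/
def interference (ω : Ω) : ℝ :=
  p.ρr * X.distR ω ^ (-p.α) * ‖X.f₁ ω ⬝ᵥ X.w ω‖ ^ 2

/-- SINR at the near user for the far user's symbol. -/
def sinr₂ (ω : Ω) : ℝ :=
  p.ρs * p.a₂ * X.dist₁ ω ^ (-p.α) * ‖X.h₁ ω‖ ^ 2 /
    (p.ρs * p.a₁ * X.dist₁ ω ^ (-p.α) * ‖X.h₁ ω‖ ^ 2 + X.interference ω + 1)

/-- SINR at the near user for its own symbol, after cancellation of the far user's symbol. -/
def sinr₁ (ω : Ω) : ℝ :=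
  p.ρs * p.a₁ * X.dist₁ ω ^ (-p.α) * ‖X.h₁ ω‖ ^ 2 / (X.interference ω + 1)

/-- Outage probability of the selected near user, given that there is at least one near user. -/
def nearOutage : ℝ :=
  1 - (P[|{ω | (X.Φn ω).Nonempty}]).real {ω | X.sinr₂ ω > p.τ₂ ∧ X.sinr₁ ω > p.τ₁}

end NNNFNetwork

end

noncomputable section

/-! When `τ₂ < a₂ / a₁`, decoding both symbols means `|h₁|² > μ ℓ^α (1 + I)` (`decoding_iff`). The
interference `I` involves the true relay distance, which depends on the direction of the near user
and on the far users. The triangle inequality traps that distance between `R₁ - ℓ` and `R₁ + ℓ`, the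
cosine-law values at `η = 1` and `η = -1`, so the success event lies almost surely between two
events that see the geometry only through `ℓ` (`ae_success_sandwich`).

The extreme events have an explicit probability (`measure_successAt`), because `ℓ`, the gain
`|f₁ᵀw|²` and `h₁` are independent. The void probabilities of the Poisson process give `ℓ` a
Rayleigh density. The beamformer is almost surely a unit vector independent of `f₁`, so `f₁ᵀw` is
`CN(0, qr)`. The exponential tail of `|h₁|²` turns the conditional success probability into a
Laplace transform of the gain, which yields `1 - F_η(r)`. Dividing by the probability of a nonempty
disc gives `P_η`.

For the quadrature, the substitution `x = (cos θ + 1) R₁ / 2` turns Gauss–Chebyshev sums into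
midpoint sums of a continuous function of `θ`. -/

/-! ### Circularly symmetric complex Gaussian laws -/

instance isProbabilityMeasure_complexGaussian (v : ℝ) :
    IsProbabilityMeasure (complexGaussian v) :=
  Measure.isProbabilityMeasure_map Complex.measurableEquivRealProd.symm.measurable.aemeasurable

theorem lintegral_complexGaussian (v : ℝ) (f : ℂ → ENNReal) :
    ∫⁻ z, f z ∂complexGaussian v =
      ∫⁻ q, f (Complex.measurableEquivRealProd.symm q)
        ∂((gaussianReal 0 (v / 2).toNNReal).prod (gaussianReal 0 (v / 2).toNNReal)) :=
  lintegral_map_equiv _ _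

theorem integral_complexGaussian {E : Type*} [NormedAddCommGroup E] [NormedSpace ℝ E]
    (v : ℝ) (f : ℂ → E) :
    ∫ z, f z ∂complexGaussian v =
      ∫ q, f (Complex.measurableEquivRealProd.symm q)
        ∂((gaussianReal 0 (v / 2).toNNReal).prod (gaussianReal 0 (v / 2).toNNReal)) :=
  integral_map_equiv _ _

theorem measurableEquivRealProd_symm_re (q : ℝ × ℝ) :
    (Complex.measurableEquivRealProd.symm q).re = q.1 := rfl

theorem measurableEquivRealProd_symm_im (q : ℝ × ℝ) :
    (Complex.measurableEquivRealProd.symm q).im = q.2 := rfl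

theorem norm_sq_eq_re_im (z : ℂ) : ‖z‖ ^ 2 = z.re ^ 2 + z.im ^ 2 := by
  rw [← Complex.normSq_eq_norm_sq, Complex.normSq_apply]; ring

theorem charFun_complexGaussian {v : ℝ} (hv : 0 ≤ v) (t : ℂ) :
    charFun (complexGaussian v) t = Complex.exp (-(v * ‖t‖ ^ 2 / 4 : ℝ)) := by
  rw [charFun_apply, integral_complexGaussian]
  have h : ∀ q : ℝ × ℝ, Complex.exp (inner ℝ (Complex.measurableEquivRealProd.symm q) t * Complex.I)
      = Complex.exp (t.re * q.1 * Complex.I) * Complex.exp (t.im * q.2 * Complex.I) := by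
    intro q
    rw [← Complex.exp_add, Complex.inner]
    congr 1
    simp only [Complex.mul_re, Complex.conj_re, Complex.conj_im, measurableEquivRealProd_symm_re,
      measurableEquivRealProd_symm_im]
    push_cast
    ring
  simp_rw [h]
  rw [integral_prod_mul (fun x : ℝ => Complex.exp (t.re * x * Complex.I))
    (fun x : ℝ => Complex.exp (t.im * x * Complex.I))]
  rw [← charFun_apply_real, ← charFun_apply_real, charFun_gaussianReal, charFun_gaussianReal,
    ← Complex.exp_add, norm_sq_eq_re_im]
  congr 1
  rw [show (((v / 2).toNNReal : ℝ) : ℂ) = ((v / 2 : ℝ) : ℂ) by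
    rw [Real.coe_toNNReal _ (by positivity)]]
  push_cast
  ring

/-- A linear combination of i.i.d. circularly symmetric Gaussian variables. -/
theorem map_dotProduct_complexGaussian {n : ℕ} {v : ℝ} (hv : 0 ≤ v) (w : Fin n → ℂ) :
    (Measure.pi fun _ : Fin n => complexGaussian v).map (fun f => f ⬝ᵥ w) =
      complexGaussian (v * ∑ i, ‖w i‖ ^ 2) := by
  have hm : Measurable fun f : Fin n → ℂ => f ⬝ᵥ w := by
    unfold dotProduct; fun_prop
  have := Measure.isProbabilityMeasure_map
    (μ := Measure.pi fun _ : Fin n => complexGaussian v) hm.aemeasurable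
  -- The characteristic function factors over the coordinates once each weight is moved to the other
  -- side of the inner product; it depends only on `‖t‖`, so the variances add with weights `‖w i‖ ^
  -- 2`.
  apply Measure.ext_of_charFun
  ext t
  rw [charFun_complexGaussian (by positivity), charFun_apply,
    integral_map hm.aemeasurable (by fun_prop)]
  have h : ∀ f : Fin n → ℂ, Complex.exp (inner ℝ (f ⬝ᵥ w) t * Complex.I) =
      ∏ i, Complex.exp (inner ℝ (f i) (star (w i) * t) * Complex.I) := by
    intro f
    rw [← Complex.exp_sum, ← Finset.sum_mul, dotProduct, sum_inner]
    congr 2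
    push_cast
    refine Finset.sum_congr rfl fun i _ => ?_
    congr 1
    simp only [Complex.inner, map_mul, Complex.star_def]
    ring_nf
  simp_rw [h]
  rw [integral_fintype_prod_eq_prod
    (fun i (z : ℂ) => Complex.exp (inner ℝ z (star (w i) * t) * Complex.I))]
  simp_rw [← charFun_apply, charFun_complexGaussian hv]
  rw [← Complex.exp_sum]
  congr 1
  push_cast
  simp only [norm_mul, norm_star, Finset.sum_neg_distrib, Finset.mul_sum, Finset.sum_mul,
    Finset.sum_div]
  push_cast
  simp only [mul_assoc, mul_pow]

theorem integral_exp_neg_mul_sq_gaussianReal {q s : ℝ} (hq : 0 ≤ q) (hs : 0 ≤ s) :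
    ∫ x, Real.exp (-(s * x ^ 2)) ∂gaussianReal 0 (q / 2).toNNReal = (√(1 + s * q))⁻¹ := by
  -- At `q = 0` the law is a Dirac mass without density; this case is needed because `qr = 0` is
  -- allowed.
  rcases hq.eq_or_lt with rfl | hq
  · simp
  have hv : (q / 2).toNNReal ≠ 0 := by simpa using hq
  rw [integral_gaussianReal_eq_integral_smul hv]
  have h : ∀ x : ℝ, gaussianPDFReal 0 (q / 2).toNNReal x • Real.exp (-(s * x ^ 2)) =
      (√(Real.pi * q))⁻¹ * Real.exp (-((1 + s * q) / q) * x ^ 2) := by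
    intro x
    rw [gaussianPDFReal, Real.coe_toNNReal _ (by positivity), smul_eq_mul, mul_assoc,
      ← Real.exp_add]
    congr 1
    · rw [show 2 * Real.pi * (q / 2) = Real.pi * q by ring]
    · congr 1
      field_simp
      ring
  simp_rw [h]
  rw [integral_const_mul, integral_gaussian, ← Real.sqrt_inv, ← Real.sqrt_inv,
    ← Real.sqrt_mul (by positivity)]
  congr 1
  have : 0 < 1 + s * q := by positivity
  field_simp

theorem integral_exp_neg_mul_norm_sq_complexGaussian {q s : ℝ} (hq : 0 ≤ q) (hs : 0 ≤ s) :
    ∫ z, Real.exp (-(s * ‖z‖ ^ 2)) ∂complexGaussian q = (1 + s * q)⁻¹ := by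
  rw [integral_complexGaussian]
  simp_rw [norm_sq_eq_re_im, measurableEquivRealProd_symm_re, measurableEquivRealProd_symm_im,
    mul_add, neg_add, Real.exp_add]
  rw [integral_prod_mul (fun x : ℝ => Real.exp (-(s * x ^ 2)))
    (fun x : ℝ => Real.exp (-(s * x ^ 2))), integral_exp_neg_mul_sq_gaussianReal hq hs,
    ← mul_inv, Real.mul_self_sqrt (by positivity)]

theorem lintegral_exp_neg_mul_norm_sq_complexGaussian {q s : ℝ} (hq : 0 ≤ q) (hs : 0 ≤ s) :
    ∫⁻ z, ENNReal.ofReal (Real.exp (-(s * ‖z‖ ^ 2))) ∂complexGaussian q =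
      ENNReal.ofReal (1 + s * q)⁻¹ := by
  rw [← integral_exp_neg_mul_norm_sq_complexGaussian hq hs,
    ofReal_integral_eq_lintegral_ofReal _ (.of_forall fun _ => by positivity)]
  refine Integrable.of_bound (by fun_prop) 1 (.of_forall fun z => ?_)
  rw [Real.norm_of_nonneg (by positivity), Real.exp_le_one_iff]
  have := mul_nonneg hs (sq_nonneg ‖z‖)
  linarith

theorem complexGaussian_singleton {v : ℝ} (hv : 0 < v) (z : ℂ) :
    complexGaussian v {z} = 0 := by
  have hv' : (v / 2).toNNReal ≠ 0 := by simpa using hv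
  have := nullSingletonClass_gaussianReal (μ := 0) hv'
  rw [complexGaussian, MeasurableEquiv.map_apply]
  refine measure_mono_null (t := ({z.re} : Set ℝ) ×ˢ Set.univ) ?_ ?_
  · rintro q hq
    have : Complex.measurableEquivRealProd.symm q = z := hq
    simp [← this]
  · rw [Measure.prod_prod]
    simp

theorem lintegral_Ioi_mul_exp_neg_sq {a : ℝ} (ha : 0 ≤ a) :
    ∫⁻ r in Set.Ioi a, ENNReal.ofReal (2 * r * Real.exp (-r ^ 2)) =
      ENNReal.ofReal (Real.exp (-a ^ 2)) := by
  have hd : ∀ x ∈ Set.Ioi a,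
      HasDerivAt (fun r : ℝ => -Real.exp (-r ^ 2)) (2 * x * Real.exp (-x ^ 2)) x := by
    intro x _
    refine (((hasDerivAt_pow 2 x).neg.exp).neg).congr_deriv ?_
    simp only [Pi.neg_apply]
    push_cast
    ring
  have hpos : ∀ x ∈ Set.Ioi a, 0 ≤ 2 * x * Real.exp (-x ^ 2) := fun x hx => by
    have : 0 ≤ x := ha.trans (le_of_lt hx)
    positivity
  have hlim : Filter.Tendsto (fun r : ℝ => -Real.exp (-r ^ 2)) Filter.atTop (nhds 0) := by
    have := (Real.tendsto_exp_neg_atTop_nhds_zero.comp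
      (Filter.tendsto_pow_atTop (α := ℝ) two_ne_zero)).neg
    simpa [Function.comp_def] using this
  have hc : ContinuousWithinAt (fun r : ℝ => -Real.exp (-r ^ 2)) (Set.Ici a) a := by fun_prop
  have hint := integrableOn_Ioi_deriv_of_nonneg hc hd hpos hlim
  rw [← ofReal_integral_eq_lintegral_ofReal hint
    ((ae_restrict_iff' measurableSet_Ioi).2 (.of_forall hpos)),
    integral_Ioi_of_hasDerivAt_of_tendsto hc hd hint hlim]
  simp

/-- The power of a standard circularly symmetric Gaussian variable is exponential. -/
theorem complexGaussian_one_norm_sq_gt {t : ℝ} (ht : 0 ≤ t) :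
    complexGaussian 1 {z | t < ‖z‖ ^ 2} = ENNReal.ofReal (Real.exp (-t)) := by
  have hms : MeasurableSet {z : ℂ | t < ‖z‖ ^ 2} := measurableSet_lt (by fun_prop) (by fun_prop)
  have hv : ((1 : ℝ) / 2).toNNReal ≠ 0 := by simp
  -- Each coordinate has variance `1/2`, so the joint density is `π⁻¹ exp (-|z|²)`. It is radial,
  -- and polar coordinates reduce the tail to an integral in the radius.
  set f : ℝ → ℝ → ENNReal := fun a r => Set.indicator (Set.Ioi t)
    (fun u => ENNReal.ofReal (Real.pi⁻¹ * Real.exp (-u))) (a ^ 2 + r ^ 2) with hf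
  have hfm : Measurable fun q : ℝ × ℝ => f q.1 q.2 := by
    have : Measurable (Set.indicator (Set.Ioi t)
      (fun u => ENNReal.ofReal (Real.pi⁻¹ * Real.exp (-u)))) :=
      Measurable.indicator (by fun_prop) measurableSet_Ioi
    exact this.comp (by fun_prop)
  have h1 : complexGaussian 1 {z | t < ‖z‖ ^ 2} = ∫⁻ q : ℝ × ℝ, f q.1 q.2 := by
    rw [← lintegral_indicator_one hms, lintegral_complexGaussian,
      gaussianReal_of_var_ne_zero _ hv, prod_withDensity (by fun_prop) (by fun_prop),
      lintegral_withDensity_eq_lintegral_mul _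
        (f := fun z : ℝ × ℝ => gaussianPDF 0 ((1 : ℝ) / 2).toNNReal z.1 *
          gaussianPDF 0 ((1 : ℝ) / 2).toNNReal z.2)
        (((measurable_gaussianPDF _ _).comp measurable_fst).mul
          ((measurable_gaussianPDF _ _).comp measurable_snd))
        (g := fun q => Set.indicator {z : ℂ | t < ‖z‖ ^ 2} 1
          (Complex.measurableEquivRealProd.symm q))
        ((measurable_one.indicator hms).comp (MeasurableEquiv.measurable _)),
      ← Measure.volume_eq_prod]
    congr 1
    ext q
    simp only [Pi.mul_apply, hf]
    by_cases h : t < q.1 ^ 2 + q.2 ^ 2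
    · rw [Set.indicator_of_mem (by simpa [norm_sq_eq_re_im, measurableEquivRealProd_symm_re,
        measurableEquivRealProd_symm_im] using h), Set.indicator_of_mem (by exact h)]
      rw [gaussianPDF, gaussianPDF, ← ENNReal.ofReal_mul (gaussianPDFReal_nonneg _ _ _)]
      simp only [gaussianPDFReal, Pi.one_apply, mul_one]
      rw [Real.coe_toNNReal _ (by positivity)]
      congr 1
      rw [mul_mul_mul_comm, ← Real.exp_add, ← mul_inv, Real.mul_self_sqrt (by positivity)]
      congr 2
      · ring
      · ring
    · rw [Set.indicator_of_notMem (by simpa [norm_sq_eq_re_im, measurableEquivRealProd_symm_re,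
        measurableEquivRealProd_symm_im] using h), Set.indicator_of_notMem (by exact h), mul_zero]
  rw [h1, ← lintegral_comp_polarCoord_symm]
  have h2 : ∀ q : ℝ × ℝ, ENNReal.ofReal q.1 • f (polarCoord.symm q).1 (polarCoord.symm q).2 =
      (ENNReal.ofReal q.1 * f 0 q.1) * 1 := by
    intro q
    simp only [polarCoord_symm_apply, hf, smul_eq_mul, mul_one]
    congr 2
    have := Real.sin_sq_add_cos_sq q.2
    linear_combination q.1 ^ 2 * this
  simp_rw [h2]
  rw [polarCoord_target, Measure.volume_eq_prod, ← Measure.prod_restrict,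
    lintegral_prod_mul (f := fun r => ENNReal.ofReal r * f 0 r) (g := fun _ => 1)]
  rotate_left
  · exact (by fun_prop : Measurable fun r : ℝ => ENNReal.ofReal r).mul
      (hfm.comp (by fun_prop : Measurable fun r : ℝ => ((0 : ℝ), r))) |>.aemeasurable
  · fun_prop
  have h3 : ∫⁻ r in Set.Ioi (0 : ℝ), ENNReal.ofReal r * f 0 r =
      ∫⁻ r in Set.Ioi √t, ENNReal.ofReal (2 * Real.pi)⁻¹ *
        ENNReal.ofReal (2 * r * Real.exp (-r ^ 2)) := by
    rw [← lintegral_indicator measurableSet_Ioi, ← lintegral_indicator measurableSet_Ioi]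
    congr 1
    ext r
    by_cases h0 : 0 < r
    · rw [Set.indicator_of_mem (by exact h0)]
      by_cases h : t < r ^ 2
      · rw [Set.indicator_of_mem (Set.mem_Ioi.2 ((Real.sqrt_lt' h0).2 h)), hf]
        simp only
        rw [Set.indicator_of_mem (by simpa using h), ← ENNReal.ofReal_mul h0.le,
          ← ENNReal.ofReal_mul (by positivity)]
        congr 1
        have := Real.pi_pos
        field_simp
        simp
      · rw [Set.indicator_of_notMem (by simpa [Real.sqrt_lt' h0] using h), hf]
        simp only
        rw [Set.indicator_of_notMem (by simpa using h), mul_zero]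
    · rw [Set.indicator_of_notMem (by exact h0), Set.indicator_of_notMem]
      intro h
      exact h0 ((Real.sqrt_nonneg t).trans_lt h)
  rw [h3, lintegral_const_mul _ (by fun_prop), lintegral_Ioi_mul_exp_neg_sq (Real.sqrt_nonneg _),
    Real.sq_sqrt ht]
  simp only [lintegral_const, one_mul, Measure.restrict_apply_univ, Real.volume_Ioo]
  rw [mul_right_comm, ← ENNReal.ofReal_mul (by positivity),
    ← ENNReal.ofReal_mul (by have := Real.pi_pos; rw [sub_neg_eq_add]; positivity)]
  congr 1
  have := Real.pi_pos
  field_simp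
  ring

/-! ### The zero-forcing beamformer -/

theorem euclNorm_sq {n : ℕ} (v : Fin n → ℂ) : euclNorm v ^ 2 = ∑ i, ‖v i‖ ^ 2 := by
  rw [euclNorm, EuclideanSpace.norm_sq_eq]

theorem euclNorm_eq_zero {n : ℕ} {v : Fin n → ℂ} : euclNorm v = 0 ↔ v = 0 := by
  rw [euclNorm, norm_eq_zero, WithLp.toLp_eq_zero]

theorem zfProjection_apply {NR NT : ℕ} (h : Fin NR → ℂ) (H : Matrix (Fin NR) (Fin NT) ℂ)
    (i j : Fin NT) :
    zfProjection h H i j = (1 : Matrix (Fin NT) (Fin NT) ℂ) i j -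
      ((((euclNorm (star h ᵥ* H)) ^ 2)⁻¹ : ℝ) : ℂ) * ((Hᴴ *ᵥ h) i * (star h ᵥ* H) j) := by
  rw [zfProjection, mul_vecMulVec, vecMulVec_mul]
  rfl

/-- The matrix is the identity minus a multiple of a rank-one matrix, and in dimension at least two
the identity does not have rank one. The argument also covers `hᴴ H = 0`, where the inverse defaults
to `0`. -/
theorem zfProjection_ne_zero {NR NT : ℕ} (hNT : 1 < NT) (h : Fin NR → ℂ)
    (H : Matrix (Fin NR) (Fin NT) ℂ) : zfProjection h H ≠ 0 := by
  intro h0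
  have key := fun i j => zfProjection_apply h H i j
  simp only [h0, Matrix.zero_apply] at key
  set i : Fin NT := ⟨0, by omega⟩
  set j : Fin NT := ⟨1, hNT⟩
  have hij : i ≠ j := by simp [i, j]
  have k1 := key i i
  have k2 := key j j
  have k3 := key i j
  rw [one_apply_eq] at k1 k2
  rw [one_apply_ne hij] at k3
  generalize ((((euclNorm (star h ᵥ* H)) ^ 2)⁻¹ : ℝ) : ℂ) = c at *
  generalize (Hᴴ *ᵥ h) = a at *
  generalize (star h ᵥ* H) = b at *
  -- A `2 × 2` minor of a rank-one matrix vanishes; for the identity it would equal `1`.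
  have : (c * (a i * b i)) * (c * (a j * b j)) = (c * (a i * b j)) * (c * (a j * b i)) := by ring
  rw [← sub_eq_zero.1 k1.symm, ← sub_eq_zero.1 k2.symm,
    show c * (a i * b j) = 0 by linear_combination k3] at this
  simp at this

theorem sum_norm_sq_zfBeamformer {NR NT : ℕ} {h : Fin NR → ℂ} {H : Matrix (Fin NR) (Fin NT) ℂ}
    {f : Fin NT → ℂ} (hf : zfProjection h H *ᵥ star f ≠ 0) :
    ∑ i, ‖zfBeamformer h H f i‖ ^ 2 = 1 := by
  rw [zfBeamformer]
  generalize zfProjection h H *ᵥ star f = u at *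
  have hu : euclNorm u ≠ 0 := fun h0 => hf (euclNorm_eq_zero.1 h0)
  simp only [Pi.smul_apply, smul_eq_mul, norm_mul, mul_pow, ← Finset.mul_sum, ← euclNorm_sq]
  simp [hu]

@[fun_prop]
theorem measurable_euclNorm {n : ℕ} : Measurable (euclNorm (n := n)) := by
  unfold euclNorm
  fun_prop

theorem measurable_norm_sq_dotProduct {β : Type*} {mβ : MeasurableSpace β} {n : ℕ}
    {f g : β → Fin n → ℂ} (hf : Measurable f) (hg : Measurable g) :
    Measurable fun ω => ‖f ω ⬝ᵥ g ω‖ ^ 2 := by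
  unfold dotProduct
  fun_prop

section

variable {β : Type*} {mβ : MeasurableSpace β} {NR NT : ℕ} {h : β → Fin NR → ℂ}
  {H : β → Fin NR → Fin NT → ℂ} {f : β → Fin NT → ℂ}

theorem measurable_zfProjection_mulVec (hh : Measurable h) (hH : Measurable H)
    (hf : Measurable f) :
    Measurable fun ω => zfProjection (h ω) (Matrix.of (H ω)) *ᵥ star (f ω) := by
  have hv : Measurable fun ω => star (h ω) ᵥ* Matrix.of (H ω) := by
    refine measurable_pi_lambda _ fun i => ?_
    simp only [vecMul, dotProduct, Matrix.of_apply, Pi.star_apply]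
    fun_prop
  have hn : Measurable fun ω => euclNorm (star (h ω) ᵥ* Matrix.of (H ω)) := by fun_prop
  refine measurable_pi_lambda _ fun i => ?_
  simp only [mulVec, dotProduct, zfProjection_apply]
  refine Finset.measurable_sum _ fun j _ => ?_
  have hvj : Measurable fun ω => (star (h ω) ᵥ* Matrix.of (H ω)) j := by fun_prop
  simp only [conjTranspose_apply, Matrix.of_apply, Pi.star_apply]
  fun_prop

theorem measurable_zfBeamformer (hh : Measurable h) (hH : Measurable H) (hf : Measurable f) :
    Measurable fun ω => zfBeamformer (h ω) (Matrix.of (H ω)) (f ω) := by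
  have hu := measurable_zfProjection_mulVec hh hH hf
  have hn : Measurable fun ω =>
    euclNorm (zfProjection (h ω) (Matrix.of (H ω)) *ᵥ star (f ω)) := by fun_prop
  unfold zfBeamformer
  refine measurable_pi_lambda _ fun i => ?_
  simp only [Pi.smul_apply, smul_eq_mul]
  fun_prop

end

/-- The image of a Gaussian vector under a nonzero matrix is almost surely nonzero. -/
theorem ae_mulVec_star_ne_zero {n : ℕ} {B : Matrix (Fin n) (Fin n) ℂ} (hB : B ≠ 0) :
    ∀ᵐ f ∂(Measure.pi fun _ : Fin n => complexGaussian 1), B *ᵥ star f ≠ 0 := by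
  obtain ⟨i, j, hij⟩ : ∃ i j, B i j ≠ 0 := by
    by_contra! h
    exact hB (by ext i j; simpa using h i j)
  have hm : Measurable fun f : Fin n → ℂ => f ⬝ᵥ star (B i) := by
    unfold dotProduct; fun_prop
  have hpos : 0 < 1 * ∑ k, ‖star (B i) k‖ ^ 2 := by
    rw [one_mul]
    refine Finset.sum_pos' (fun _ _ => by positivity) ⟨j, Finset.mem_univ _, ?_⟩
    simp only [Pi.star_apply, norm_star]
    positivity
  -- A nonzero row of `B` gives a Gaussian coordinate of positive variance, which has no atom at
  -- `0`.
  have h0 := complexGaussian_singleton hpos 0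
  rw [← map_dotProduct_complexGaussian zero_le_one,
    Measure.map_apply hm (measurableSet_singleton 0)] at h0
  refine measure_mono_null ?_ h0
  intro f hf
  simp only [ne_eq, Set.mem_compl_iff, Set.mem_ofPred_eq, not_not] at hf
  have h1 : B i ⬝ᵥ star f = 0 := congrFun hf i
  simp only [Set.mem_preimage, Set.mem_singleton_iff]
  have h2 : f ⬝ᵥ star (B i) = star (B i ⬝ᵥ star f) := by
    simp [dotProduct, mul_comm]
  rw [h2, h1, star_zero]

/-! ### Void probabilities and the law of the nearest distance -/

namespace IsPoissonPointProcess

variable {Ω : Type*} [MeasurableSpace Ω] {P : Measure Ω} {D : Set ℂ} {lam : ℝ} {Φ : Ω → Set ℂ}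

theorem pointCount_eq_zero_iff (h : IsPoissonPointProcess P D lam Φ) {B : Set ℂ} {ω : Ω} :
    pointCount Φ B ω = 0 ↔ Φ ω ∩ B = ∅ :=
  Set.ncard_eq_zero ((h.finite ω).inter_of_left B)

theorem pointSigma_le (h : IsPoissonPointProcess P D lam Φ) :
    pointSigma Φ ≤ (inferInstance : MeasurableSpace Ω) :=
  iSup₂_le fun B hB => (h.measurable_count B hB).comap_le

theorem measure_pointCount_eq_zero (h : IsPoissonPointProcess P D lam Φ) {B : Set ℂ}
    (hB : MeasurableSet B) (hlam : 0 ≤ lam) :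
    P {ω | pointCount Φ B ω = 0} =
      ENNReal.ofReal (Real.exp (-(lam * volume.real (B ∩ D)))) := by
  have h1 : {ω | pointCount Φ B ω = 0} = pointCount Φ B ⁻¹' {0} := rfl
  rw [h1, ← Measure.map_apply (h.measurable_count B hB) (measurableSet_singleton 0),
    h.law_count B hB, poissonMeasure_singleton, Real.coe_toNNReal _ (by positivity)]
  simp

end IsPoissonPointProcess

theorem measurable_pointCount_pointSigma {Ω : Type*} (Φ : Ω → Set ℂ) {B : Set ℂ}
    (hB : MeasurableSet B) : Measurable[pointSigma Φ] (pointCount Φ B) :=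
  measurable_iff_comap_le.2 (le_iSup₂_of_le B hB le_rfl)

theorem hasDerivAt_neg_exp_neg_mul_sq (lam x : ℝ) :
    HasDerivAt (fun x : ℝ => -Real.exp (-(Real.pi * lam * x ^ 2)))
      (2 * Real.pi * lam * (x * Real.exp (-(Real.pi * lam * x ^ 2)))) x := by
  refine ((((hasDerivAt_pow 2 x).const_mul (Real.pi * lam)).neg.exp).neg).congr_deriv ?_
  simp only [Pi.neg_apply]
  push_cast
  ring

theorem lintegral_Ioc_density {lam r : ℝ} (hlam : 0 ≤ lam) (hr : 0 ≤ r) :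
    ∫⁻ x in Set.Ioc 0 r,
      ENNReal.ofReal (2 * Real.pi * lam * (x * Real.exp (-(Real.pi * lam * x ^ 2)))) =
      ENNReal.ofReal (1 - Real.exp (-(Real.pi * lam * r ^ 2))) := by
  have hc : Continuous fun x : ℝ =>
    2 * Real.pi * lam * (x * Real.exp (-(Real.pi * lam * x ^ 2))) := by fun_prop
  rw [← ofReal_integral_eq_lintegral_ofReal, ← intervalIntegral.integral_of_le hr,
    intervalIntegral.integral_eq_sub_of_hasDerivAt
      (fun x _ => hasDerivAt_neg_exp_neg_mul_sq lam x) (hc.intervalIntegrable _ _)]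
  · congr 1
    simp
    ring
  · exact (hc.integrableOn_Icc).mono_set Set.Ioc_subset_Icc_self
  · refine (ae_restrict_iff' measurableSet_Ioc).2 (.of_forall fun x hx => ?_)
    have := hx.1
    have := Real.pi_pos
    positivity

namespace NNNFNetwork

variable {Ω : Type*} [MeasurableSpace Ω] {p : NomaParams} {P : Measure Ω}
  (X : NNNFNetwork p P)

open Classical in
/-- Distance from the base station to the nearest near user, set to a value exceeding the radius
of the disc when there is no near user. -/
def nearDist (ω : Ω) : ℝ := if (X.Φn ω).Nonempty then ‖X.U₁ ω‖ else p.R₁ + 1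

theorem nearDist_le_R₁_iff (ω : Ω) : X.nearDist ω ≤ p.R₁ ↔ (X.Φn ω).Nonempty := by
  rw [nearDist]
  split_ifs with h
  · exact iff_of_true (X.poisson_near.subset_region ω (X.nearest_U₁ ω h).1) h
  · exact iff_of_false (by linarith) h

theorem nearDist_le_iff {r : ℝ} (hr : r < p.R₁ + 1) (ω : Ω) :
    X.nearDist ω ≤ r ↔ pointCount X.Φn (Metric.closedBall 0 r) ω ≠ 0 := by
  rw [Ne, X.poisson_near.pointCount_eq_zero_iff, ← Ne, ← Set.nonempty_iff_ne_empty, nearDist]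
  split_ifs with h
  · obtain ⟨h1, h2⟩ := X.nearest_U₁ ω h
    constructor
    · intro h3
      exact ⟨_, h1, by simpa using h3⟩
    · rintro ⟨y, hy, hy'⟩
      exact (h2 y hy).trans (by simpa using hy')
  · refine iff_of_false (by linarith) ?_
    rintro ⟨y, hy, -⟩
    exact h ⟨y, hy⟩

/-- Independence is assumed only for the σ-algebra of the counts, and `U₁` need not be measurable
for it. The distance is, since its sublevel sets are events that a disc is not void. -/
theorem measurable_nearDist_pointSigma : Measurable[pointSigma X.Φn] X.nearDist := by
  refine measurable_of_Iic (mδ := pointSigma X.Φn) fun r => ?_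
  rcases lt_or_ge r (p.R₁ + 1) with hr | hr
  · have : X.nearDist ⁻¹' Set.Iic r =
        pointCount X.Φn (Metric.closedBall 0 r) ⁻¹' {0}ᶜ := by
      ext ω
      exact X.nearDist_le_iff hr ω
    rw [this]
    exact measurable_pointCount_pointSigma _ measurableSet_closedBall
      (measurableSet_singleton 0).compl
  · have : X.nearDist ⁻¹' Set.Iic r = Set.univ := by
      ext ω
      simp only [Set.mem_preimage, Set.mem_Iic, Set.mem_univ, iff_true]
      by_cases h : (X.Φn ω).Nonempty
      · exact ((X.nearDist_le_R₁_iff ω).2 h).trans (by linarith)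
      · simpa [nearDist, h] using hr
    rw [this]
    exact MeasurableSet.univ

theorem measurable_nearDist : Measurable X.nearDist :=
  X.measurable_nearDist_pointSigma.mono X.poisson_near.pointSigma_le le_rfl

/-- The complement is the void event of a disc of radius `r`. Negative radii, covered by `max r 0`,
are included so that the distribution function is known on a whole half-line. -/
theorem measure_nearDist_le [IsProbabilityMeasure P] {r : ℝ} (hr : r ≤ p.R₁) :
    P {ω | X.nearDist ω ≤ r} =
      ENNReal.ofReal (1 - Real.exp (-(Real.pi * p.lamN * max r 0 ^ 2))) := by
  have hm : MeasurableSet {ω | pointCount X.Φn (Metric.closedBall 0 r) ω = 0} :=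
    X.poisson_near.measurable_count _ measurableSet_closedBall (measurableSet_singleton 0)
  have h1 : {ω | X.nearDist ω ≤ r} =
      {ω | pointCount X.Φn (Metric.closedBall 0 r) ω = 0}ᶜ := by
    ext ω
    exact X.nearDist_le_iff (by linarith) ω
  have h2 : Metric.closedBall 0 r ∩ p.nearDisc = Metric.closedBall 0 r := by
    refine Set.inter_eq_left.2 fun z hz => ?_
    have : ‖z‖ ≤ r := by simpa using hz
    exact this.trans hr
  rw [h1, prob_compl_eq_one_sub hm,
    X.poisson_near.measure_pointCount_eq_zero measurableSet_closedBall p.lamN_pos.le, h2,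
    Measure.real, Complex.volume_closedBall, ENNReal.ofReal_sub _ (by positivity),
    ENNReal.ofReal_one]
  congr 4
  simp only [ENNReal.toReal_mul, ENNReal.toReal_pow, ENNReal.toReal_ofReal', ENNReal.coe_toReal,
    NNReal.coe_real_pi]
  ring

/-- On the disc, the distance to the nearest near user has a Rayleigh density. -/
theorem map_nearDist_restrict [IsProbabilityMeasure P] :
    (P.map X.nearDist).restrict (Set.Iic p.R₁) =
      (volume.restrict (Set.Ioc 0 p.R₁)).withDensity fun x =>
        ENNReal.ofReal (2 * Real.pi * p.lamN * (x * Real.exp (-(Real.pi * p.lamN * x ^ 2)))) := by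
  have := Measure.isProbabilityMeasure_map (μ := P) X.measurable_nearDist.aemeasurable
  refine Measure.ext_of_Iic _ _ fun a => ?_
  rw [Measure.restrict_apply measurableSet_Iic, withDensity_apply _ measurableSet_Iic,
    Measure.restrict_restrict measurableSet_Iic, Set.Iic_inter_Iic,
    Measure.map_apply X.measurable_nearDist measurableSet_Iic]
  have h1 : Set.Iic a ∩ Set.Ioc 0 p.R₁ = Set.Ioc 0 (max (min a p.R₁) 0) := by
    ext x
    have := p.R₁_pos
    simp only [Set.mem_inter_iff, Set.mem_Iic, Set.mem_Ioc, le_max_iff, le_min_iff]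
    constructor
    · rintro ⟨h1, h2, h3⟩
      exact ⟨h2, Or.inl ⟨h1, h3⟩⟩
    · rintro ⟨h1, h2 | h2⟩
      · exact ⟨h2.1, h1, h2.2⟩
      · linarith
  rw [h1, lintegral_Ioc_density p.lamN_pos.le (le_max_right _ _)]
  exact X.measure_nearDist_le (min_le_right _ _)

end NNNFNetwork

/-! ### Convergence of Gauss–Chebyshev quadrature -/

/-- Midpoint Riemann sums of a continuous function converge to its integral. -/
theorem tendsto_midpoint_sum {G : ℝ → ℝ} {b : ℝ} (hb : 0 < b)
    (hG : ContinuousOn G (Set.Icc 0 b)) :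
    Filter.Tendsto
      (fun M : ℕ => b / M * ∑ m ∈ Finset.Icc 1 M, G ((2 * m - 1) / (2 * M) * b)) Filter.atTop
      (nhds (∫ x in (0 : ℝ)..b, G x)) := by
  rw [Metric.tendsto_atTop]
  intro ε hε
  obtain ⟨δ, hδ, hδG⟩ := Metric.uniformContinuousOn_iff.1
    (isCompact_Icc.uniformContinuousOn_of_continuous hG) (ε / (2 * b)) (by positivity)
  obtain ⟨N, hN⟩ := exists_nat_gt (b / δ)
  refine ⟨N + 1, fun M hM => ?_⟩
  have hM0 : (0 : ℝ) < M := by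
    have : 0 < M := by omega
    exact_mod_cast this
  have hNM : (N : ℝ) < M := by exact_mod_cast hM
  set h : ℝ := b / M with hh
  have hh0 : 0 < h := by positivity
  have hhδ : h < δ := by
    rw [hh, div_lt_comm₀ hM0 hδ]
    exact hN.trans hNM
  have hMh : M * h = b := by rw [hh]; field_simp
  have hsub : ∀ k < M, Set.Icc (k * h) ((k + 1 : ℕ) * h) ⊆ Set.Icc 0 b := by
    intro k hk
    refine Set.Icc_subset_Icc (by positivity) ?_
    rw [← hMh]
    have : ((k + 1 : ℕ) : ℝ) ≤ M := by exact_mod_cast hk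
    gcongr
  have hle : ∀ k : ℕ, (k : ℝ) * h ≤ (k + 1 : ℕ) * h := fun k => by
    push_cast
    nlinarith
  have hint : ∀ k < M, IntervalIntegrable G volume ((k : ℕ) * h) ((k + 1 : ℕ) * h) := by
    intro k hk
    refine ContinuousOn.intervalIntegrable ?_
    rw [Set.uIcc_of_le (hle k)]
    exact hG.mono (hsub k hk)
  have hsum := intervalIntegral.sum_integral_adjacent_intervals (f := G) (μ := volume)
    (a := fun k : ℕ => (k : ℝ) * h) (n := M) hint
  simp only [Nat.cast_zero, zero_mul, hMh] at hsum
  rw [← hsum, Finset.mul_sum, ← Finset.Ico_add_one_right_eq_Icc, Finset.sum_Ico_eq_sum_range,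
    dist_eq_norm, Nat.add_sub_cancel, ← Finset.sum_sub_distrib]
  have hterm : ∀ k ∈ Finset.range M,
      ‖h * G ((2 * ((1 + k : ℕ) : ℝ) - 1) / (2 * M) * b) -
        ∫ x in (k * h : ℝ)..((k + 1 : ℕ) * h), G x‖ ≤ ε / (2 * b) * h := by
    intro k hk
    have hk := Finset.mem_range.1 hk
    set c : ℝ := (2 * ((1 + k : ℕ) : ℝ) - 1) / (2 * M) * b with hc
    have hc' : c = (k + 1 / 2) * h := by
      rw [hc, hh]
      push_cast
      field_simp
      -- With `m = k + 1`, the sample point is the midpoint of the `k`-th subinterval.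
      ring
    have hlen : ((k + 1 : ℕ) : ℝ) * h - k * h = h := by push_cast; ring
    have hcmem : c ∈ Set.Icc (k * h) ((k + 1 : ℕ) * h) := by
      rw [hc']
      push_cast
      constructor <;> nlinarith
    have : h * G c = ∫ x in (k * h : ℝ)..((k + 1 : ℕ) * h), G c := by
      rw [intervalIntegral.integral_const, hlen, smul_eq_mul]
    rw [this, ← intervalIntegral.integral_sub intervalIntegrable_const (hint k hk)]
    refine (intervalIntegral.norm_integral_le_of_norm_le_const fun x hx => ?_).trans_eq
      (b := ε / (2 * b) * |((k + 1 : ℕ) : ℝ) * h - k * h|) (by rw [hlen, abs_of_pos hh0])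
    rw [Set.uIoc_of_le (hle k)] at hx
    have hx' := Set.Ioc_subset_Icc_self hx
    rw [← dist_eq_norm]
    refine (hδG c (hsub k hk hcmem) x (hsub k hk hx') ?_).le
    refine lt_of_le_of_lt (Real.dist_le_of_mem_Icc hcmem hx') ?_
    rwa [hlen]
  calc _ ≤ ∑ k ∈ Finset.range M, ε / (2 * b) * h := norm_sum_le_of_le _ hterm
    _ = ε / 2 := by
      rw [Finset.sum_const, Finset.card_range, nsmul_eq_mul, mul_left_comm, hMh]
      field_simp
    _ < ε := by linarith

/-- Gauss–Chebyshev quadrature converges for bounded functions that may jump at the right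
endpoint. -/
theorem tendsto_chebyshev_sum {g : ℝ → ℝ} {R C : ℝ} (hR : 0 < R)
    (hg : ContinuousOn g (Set.Ico 0 R)) (hC : ∀ x ∈ Set.Icc 0 R, |g x| ≤ C) :
    Filter.Tendsto
      (fun M : ℕ => Real.pi * R / (2 * M) *
        ∑ m ∈ Finset.Icc 1 M, √(1 - NomaParams.φ M m ^ 2) *
          g ((NomaParams.φ M m + 1) * (R / 2))) Filter.atTop
      (nhds (∫ x in (0 : ℝ)..R, g x)) := by
  set f : ℝ → ℝ := fun θ => (Real.cos θ + 1) * (R / 2) with hf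
  set G : ℝ → ℝ := fun θ => Real.sin θ * g (f θ) with hGdef
  have hpi := Real.pi_pos
  have hf_mem : ∀ θ, f θ ∈ Set.Icc 0 R := fun θ => by
    have h1 := Real.neg_one_le_cos θ
    have h2 := Real.cos_le_one θ
    constructor <;> simp only [hf] <;> nlinarith
  have hf_lt : ∀ θ ∈ Set.Ioc 0 Real.pi, f θ ∈ Set.Ico 0 R := fun θ hθ => by
    refine ⟨(hf_mem θ).1, ?_⟩
    have := Real.cos_lt_cos_of_nonneg_of_le_pi le_rfl hθ.2 hθ.1
    rw [Real.cos_zero] at this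
    simp only [hf]
    nlinarith
  have hfc : Continuous f := by fun_prop
  -- A jump of `g` at `R` corresponds to `θ = 0`, where the factor `sin θ` tends to `0` while `g`
  -- stays bounded.
  have hGc : ContinuousOn G (Set.Icc 0 Real.pi) := by
    intro θ hθ
    rcases hθ.1.eq_or_lt with rfl | h0
    · have hlim : Filter.Tendsto (fun θ => C * |Real.sin θ|) (nhdsWithin 0 (Set.Icc 0 Real.pi))
          (nhds 0) := by
        have : Continuous fun θ => C * |Real.sin θ| := by fun_prop
        simpa using (this.tendsto 0).mono_left nhdsWithin_le_nhds
      have hG0 : G 0 = 0 := by simp [hGdef]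
      rw [ContinuousWithinAt, hG0]
      refine squeeze_zero_norm (fun θ => ?_) hlim
      rw [hGdef, Real.norm_eq_abs, abs_mul, mul_comm]
      exact mul_le_mul_of_nonneg_right (hC _ (hf_mem θ)) (abs_nonneg _)
    · have h1 : ContinuousOn G (Set.Ioc 0 Real.pi) :=
        Real.continuous_sin.continuousOn.mul (hg.comp hfc.continuousOn hf_lt)
      refine (h1 θ ⟨h0, hθ.2⟩).mono_of_mem_nhdsWithin ?_
      rw [mem_nhdsWithin]
      exact ⟨Set.Ioi 0, isOpen_Ioi, h0, fun x hx => ⟨hx.1, hx.2.2⟩⟩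
  have hgint : IntegrableOn g (Set.Icc 0 R) := by
    rw [integrableOn_Icc_iff_integrableOn_Ico]
    refine IntegrableOn.of_bound (by simp) (hg.aestronglyMeasurable measurableSet_Ico) C ?_
    exact (ae_restrict_iff' measurableSet_Ico).2
      (.of_forall fun x hx => hC x (Set.Ico_subset_Icc_self hx))
  have hsubst : ∫ θ in (0 : ℝ)..Real.pi, G θ = 2 / R * ∫ x in (0 : ℝ)..R, g x := by
    have hG' : ∀ θ, (g ∘ f) θ * (-Real.sin θ * (R / 2)) = -(R / 2) * G θ := fun θ => by
      simp only [hGdef, Function.comp]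
      ring
    have key := intervalIntegral.integral_comp_mul_deriv''' (a := 0) (b := Real.pi) (f := f)
      (f' := fun θ => -Real.sin θ * (R / 2)) (g := g) hfc.continuousOn
      (fun θ _ => (((Real.hasDerivAt_cos θ).add_const 1).mul_const (R / 2)).hasDerivWithinAt)
      (hg.mono (by
        rintro _ ⟨θ, hθ, rfl⟩
        rw [min_eq_left hpi.le, max_eq_right hpi.le] at hθ
        exact hf_lt θ ⟨hθ.1, hθ.2.le⟩))
      (hgint.mono_set (by
        rintro _ ⟨θ, -, rfl⟩
        exact hf_mem θ))
      (by
        simp_rw [hG']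
        rw [Set.uIcc_of_le hpi.le]
        exact (hGc.const_smul (-(R / 2))).integrableOn_Icc)
    simp_rw [hG'] at key
    rw [intervalIntegral.integral_const_mul] at key
    have e0 : f 0 = R := by
      simp only [hf, Real.cos_zero]
      ring
    have e1 : f Real.pi = 0 := by simp [hf]
    rw [e0, e1, intervalIntegral.integral_symm 0 R] at key
    field_simp
    linarith
  have hlim := (tendsto_midpoint_sum hpi hGc).const_mul (R / 2)
  rw [hsubst] at hlim
  convert hlim using 2 with M
  · rw [← mul_assoc]
    congr 1
    · rcases Nat.eq_zero_or_pos M with rfl | hM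
      · simp
      · field_simp
    · refine Finset.sum_congr rfl fun m hm => ?_
      obtain ⟨hm1, hm2⟩ := Finset.mem_Icc.1 hm
      have hm1' : (1 : ℝ) ≤ m := by exact_mod_cast hm1
      have hm2' : (m : ℝ) ≤ M := by exact_mod_cast hm2
      simp only [hGdef, hf, NomaParams.φ]
      congr 1
      rw [← Real.sin_eq_sqrt_one_sub_cos_sq]
      · have : 0 ≤ (2 * (m : ℝ) - 1) / (2 * M) := div_nonneg (by linarith) (by linarith)
        positivity
      · have : (2 * (m : ℝ) - 1) / (2 * M) ≤ 1 := (div_le_one (by linarith)).2 (by linarith)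
        nlinarith
  · field_simp

/-! ### Regularity of the outage integrand -/

namespace NomaParams

variable (p : NomaParams)

theorem ρs_pos : 0 < p.ρs := div_pos p.PS_pos p.noise_pos

theorem ρr_pos : 0 < p.ρr := div_pos p.PR_pos p.noise_pos

theorem τ₁_pos : 0 < p.τ₁ := sub_pos.2 (Real.one_lt_rpow one_lt_two p.rate₁_pos)

theorem τ₂_pos : 0 < p.τ₂ := sub_pos.2 (Real.one_lt_rpow one_lt_two p.rate₂_pos)

theorem μ_pos : 0 < p.μ :=
  lt_max_of_lt_right (div_pos p.τ₁_pos (mul_pos p.ρs_pos p.a₁_pos))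

theorem α_pos : 0 < p.α := two_pos.trans_le p.two_le_α

theorem sq_sub_le_cosine_law {η r : ℝ} (hη : η ≤ 1) (hr : 0 ≤ r) :
    (p.R₁ - r) ^ 2 ≤ p.R₁ ^ 2 + r ^ 2 - 2 * η * p.R₁ * r := by
  have := mul_nonneg (sub_nonneg.2 hη) (mul_nonneg p.R₁_pos.le hr)
  nlinarith

theorem one_le_outageAt_denom {η r : ℝ} (hη : η ≤ 1) (hr : 0 ≤ r) :
    1 ≤ 1 + p.qr * p.ρr * p.μ * r ^ p.α *
      (p.R₁ ^ 2 + r ^ 2 - 2 * η * p.R₁ * r) ^ (-p.α / 2) := by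
  have h1 := (sq_nonneg _).trans (p.sq_sub_le_cosine_law hη hr)
  have := p.qr_nonneg
  have := p.ρr_pos
  have := p.μ_pos
  have : 0 ≤ p.qr * p.ρr * p.μ * r ^ p.α *
      (p.R₁ ^ 2 + r ^ 2 - 2 * η * p.R₁ * r) ^ (-p.α / 2) := by positivity
  linarith

theorem outageAt_mem_Icc {η r : ℝ} (hη : η ≤ 1) (hr : 0 ≤ r) :
    p.outageAt η r ∈ Set.Icc 0 1 := by
  have h1 := p.one_le_outageAt_denom hη hr
  have h2 : Real.exp (-(p.μ * r ^ p.α)) ≤ 1 := by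
    have := p.μ_pos
    rw [Real.exp_le_one_iff, neg_nonpos]
    positivity
  have h3 := (div_le_one (zero_lt_one.trans_le h1)).2 (h2.trans h1)
  have h4 := div_nonneg (Real.exp_pos (-(p.μ * r ^ p.α))).le (zero_le_one.trans h1)
  constructor <;> rw [outageAt] <;> linarith

/-- The endpoint `R₁` is left out because for `η = 1` the base vanishes there: the power with
negative exponent blows up nearby but takes the value `0` at the point itself. -/
theorem continuousOn_outageAt {η : ℝ} (hη : η ≤ 1) :
    ContinuousOn (p.outageAt η) (Set.Ico 0 p.R₁) := by
  have hα := p.α_pos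
  have h1 : Continuous fun r : ℝ => r ^ p.α := Real.continuous_rpow_const hα.le
  have h2 : ContinuousOn (fun r : ℝ =>
      (p.R₁ ^ 2 + r ^ 2 - 2 * η * p.R₁ * r) ^ (-p.α / 2)) (Set.Ico 0 p.R₁) := by
    refine ContinuousOn.rpow_const (by fun_prop) fun r hr => Or.inl ?_
    have h3 := p.sq_sub_le_cosine_law hη hr.1
    have : 0 < (p.R₁ - r) ^ 2 := by
      have := sub_pos.2 hr.2
      positivity
    linarith
  refine continuousOn_const.sub (ContinuousOn.div (by fun_prop) ?_ fun r hr => ?_)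
  · exact continuousOn_const.add ((continuousOn_const.mul h1.continuousOn).mul h2)
  · exact (zero_lt_one.trans_le (p.one_le_outageAt_denom hη hr.1)).ne'

theorem tendsto_chebyshevSum {η : ℝ} (hη : η ≤ 1) :
    Filter.Tendsto (fun M : ℕ => p.chebyshevSum η M) Filter.atTop (nhds (p.outageBound η)) := by
  have hg : ContinuousOn (fun r => r * Real.exp (-(Real.pi * p.lamN * r ^ 2)) * p.outageAt η r)
      (Set.Ico 0 p.R₁) := by
    have := p.continuousOn_outageAt hη
    fun_prop
  have hb : ∀ r ∈ Set.Icc 0 p.R₁,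
      |r * Real.exp (-(Real.pi * p.lamN * r ^ 2)) * p.outageAt η r| ≤ p.R₁ := by
    intro r hr
    have h1 := p.outageAt_mem_Icc hη hr.1
    have h2 : Real.exp (-(Real.pi * p.lamN * r ^ 2)) ≤ 1 := by
      have := p.lamN_pos
      have := Real.pi_pos
      rw [Real.exp_le_one_iff, neg_nonpos]
      positivity
    have h0 := hr.1
    rw [abs_of_nonneg (mul_nonneg (by positivity) h1.1)]
    refine (mul_le_of_le_one_right (by positivity) h1.2).trans ?_
    exact (mul_le_of_le_one_right h0 h2).trans hr.2
  convert (tendsto_chebyshev_sum p.R₁_pos hg hb).const_mul p.υn using 2 with M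
  rw [chebyshevSum, ← mul_assoc]
  congr 1
  · ring
  · refine Finset.sum_congr rfl fun m _ => ?_
    rw [c]
    ring
  · rfl

end NomaParams

/-! ### Independence and the fading probabilities -/

namespace NNNFNetwork

variable {Ω : Type*} [MeasurableSpace Ω] {p : NomaParams} {P : Measure Ω}
  (X : NNNFNetwork p P)

/-- The independent sources of randomness of the network. -/
@[reducible] def sources : Fin 7 → MeasurableSpace Ω :=
  ![pointSigma X.Φn, pointSigma X.Φf,
    MeasurableSpace.comap X.h₁ inferInstance, MeasurableSpace.comap X.f₁ inferInstance,
    MeasurableSpace.comap X.hR inferInstance, MeasurableSpace.comap X.HRR inferInstance,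
    MeasurableSpace.comap X.f₂ inferInstance]

theorem sources_le (i : Fin 7) : X.sources i ≤ (inferInstance : MeasurableSpace Ω) := by
  fin_cases i
  · exact X.poisson_near.pointSigma_le
  · exact X.poisson_far.pointSigma_le
  · exact X.measurable_h₁.comap_le
  · exact X.measurable_f₁.comap_le
  · exact X.measurable_hR.comap_le
  · exact X.measurable_HRR.comap_le
  · exact X.measurable_f₂.comap_le

theorem indepFun_of_disjoint_sources {β γ : Type*} [MeasurableSpace β] [MeasurableSpace γ]
    {f : Ω → β} {g : Ω → γ} {S T : Set (Fin 7)} (hST : Disjoint S T)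
    (hf : Measurable[⨆ i ∈ S, X.sources i] f) (hg : Measurable[⨆ i ∈ T, X.sources i] g) :
    IndepFun f g P := by
  have h := indep_iSup_of_disjoint X.sources_le X.indep hST
  exact indep_of_indep_of_le_left (indep_of_indep_of_le_right h hg.comap_le) hf.comap_le

theorem measurable_iSup_sources {β : Type*} [MeasurableSpace β] {f : Ω → β} {S : Set (Fin 7)}
    {i : Fin 7} (hi : i ∈ S) (hf : Measurable[X.sources i] f) :
    Measurable[⨆ i ∈ S, X.sources i] f :=
  hf.mono (le_iSup₂_of_le i hi le_rfl) le_rfl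

theorem measurable_sources_h₁ : Measurable[X.sources 2] X.h₁ := comap_measurable _

theorem measurable_sources_f₁ : Measurable[X.sources 3] X.f₁ := comap_measurable _

theorem measurable_sources_hR : Measurable[X.sources 4] X.hR := comap_measurable _

theorem measurable_sources_HRR : Measurable[X.sources 5] X.HRR := comap_measurable _

theorem measurable_sources_f₂ : Measurable[X.sources 6] X.f₂ := comap_measurable _

theorem measurable_iSup_sources_w {S : Set (Fin 7)} (h4 : 4 ∈ S) (h5 : 5 ∈ S) (h6 : 6 ∈ S) :
    Measurable[⨆ i ∈ S, X.sources i] X.w := by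
  exact measurable_zfBeamformer (X.measurable_iSup_sources h4 X.measurable_sources_hR)
    (X.measurable_iSup_sources h5 X.measurable_sources_HRR)
    (X.measurable_iSup_sources h6 X.measurable_sources_f₂)

theorem measurable_w : Measurable X.w :=
  (X.measurable_iSup_sources_w (S := Set.univ) trivial trivial trivial).mono
    (iSup₂_le fun i _ => X.sources_le i) le_rfl

/-- Power gain of the beamformed interference channel. -/
def interferenceGain (ω : Ω) : ℝ := ‖X.f₁ ω ⬝ᵥ X.w ω‖ ^ 2

theorem measurable_iSup_sources_interferenceGain {S : Set (Fin 7)} (h3 : 3 ∈ S) (h4 : 4 ∈ S)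
    (h5 : 5 ∈ S) (h6 : 6 ∈ S) : Measurable[⨆ i ∈ S, X.sources i] X.interferenceGain := by
  exact measurable_norm_sq_dotProduct (X.measurable_iSup_sources h3 X.measurable_sources_f₁)
    (X.measurable_iSup_sources_w h4 h5 h6)

theorem measurable_interferenceGain : Measurable X.interferenceGain := by
  exact measurable_norm_sq_dotProduct X.measurable_f₁ X.measurable_w

theorem indepFun_f₁_w : IndepFun X.f₁ X.w P :=
  X.indepFun_of_disjoint_sources (S := {3}) (T := {4, 5, 6}) (by simp)
    (X.measurable_iSup_sources (by simp) X.measurable_sources_f₁)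
    (X.measurable_iSup_sources_w (by simp) (by simp) (by simp))

theorem indepFun_interferenceGain_h₁ : IndepFun X.interferenceGain X.h₁ P :=
  X.indepFun_of_disjoint_sources (S := {3, 4, 5, 6}) (T := {2}) (by simp)
    (X.measurable_iSup_sources_interferenceGain (by simp) (by simp) (by simp) (by simp))
    (X.measurable_iSup_sources (by simp) X.measurable_sources_h₁)

/-- Only the distance of the near user enters here. The relay distance is absent, as it mixes the
far users with the direction of `U₁`. -/
theorem indepFun_nearDist_interferenceGain_h₁ :
    IndepFun X.nearDist (fun ω => (X.interferenceGain ω, X.h₁ ω)) P :=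
  X.indepFun_of_disjoint_sources (S := {0}) (T := {2, 3, 4, 5, 6}) (by simp)
    (X.measurable_iSup_sources (i := 0) (by simp) X.measurable_nearDist_pointSigma)
    ((X.measurable_iSup_sources_interferenceGain (by simp) (by simp) (by simp) (by simp)).prodMk
      (X.measurable_iSup_sources (by simp) X.measurable_sources_h₁))

theorem indepFun_relay_f₂ : IndepFun (fun ω => (X.hR ω, X.HRR ω)) X.f₂ P :=
  X.indepFun_of_disjoint_sources (S := {4, 5}) (T := {6}) (by simp)
    ((X.measurable_iSup_sources (by simp) X.measurable_sources_hR).prodMk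
      (X.measurable_iSup_sources (by simp) X.measurable_sources_HRR))
    (X.measurable_iSup_sources (by simp) X.measurable_sources_f₂)

variable [IsProbabilityMeasure P]

/-- Normalization fails only when `B f₂* = 0`. Since `f₂` is independent of the nonzero matrix `B`,
Fubini makes this a null event. -/
theorem ae_sum_norm_sq_w : ∀ᵐ ω ∂P, ∑ i, ‖X.w ω i‖ ^ 2 = 1 := by
  have hm := X.measurable_hR.prodMk X.measurable_HRR
  have hmap := (indepFun_iff_map_prod_eq_prod_map_map hm.aemeasurable
    X.measurable_f₂.aemeasurable).1 X.indepFun_relay_f₂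
  have hs : MeasurableSet {T : ((Fin p.NR → ℂ) × (Fin p.NR → Fin p.NT → ℂ)) × (Fin p.NT → ℂ) |
      zfProjection T.1.1 (Matrix.of T.1.2) *ᵥ star T.2 = 0} :=
    measurable_zfProjection_mulVec (by fun_prop) (by fun_prop) (by fun_prop)
      (measurableSet_singleton 0)
  have h0 : (P.map fun ω => ((X.hR ω, X.HRR ω), X.f₂ ω))
      {T | zfProjection T.1.1 (Matrix.of T.1.2) *ᵥ star T.2 = 0} = 0 := by
    rw [hmap, Measure.measure_prod_null hs, X.law_f₂]
    refine .of_forall fun T => ?_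
    have := ae_mulVec_star_ne_zero (zfProjection_ne_zero p.one_lt_NT T.1 (Matrix.of T.2))
    simpa [ae_iff] using this
  rw [Measure.map_apply (hm.prodMk X.measurable_f₂) hs] at h0
  filter_upwards [measure_eq_zero_iff_ae_notMem.1 h0] with ω hω
  exact sum_norm_sq_zfBeamformer hω

/-- Laplace transform of the interference gain: it is exponential with mean `qr`. -/
theorem lintegral_exp_neg_interferenceGain {s : ℝ} (hs : 0 ≤ s) :
    ∫⁻ ω, ENNReal.ofReal (Real.exp (-(s * X.interferenceGain ω))) ∂P =
      ENNReal.ofReal (1 + s * p.qr)⁻¹ := by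
  have hmap := (indepFun_iff_map_prod_eq_prod_map_map X.measurable_f₁.aemeasurable
    X.measurable_w.aemeasurable).1 X.indepFun_f₁_w
  have hF : Measurable fun q : (Fin p.NT → ℂ) × (Fin p.NT → ℂ) =>
      ENNReal.ofReal (Real.exp (-(s * ‖q.1 ⬝ᵥ q.2‖ ^ 2))) := by
    have := measurable_norm_sq_dotProduct (n := p.NT) measurable_fst measurable_snd
    fun_prop
  have := Measure.isProbabilityMeasure_map (μ := P) X.measurable_f₁.aemeasurable
  have := Measure.isProbabilityMeasure_map (μ := P) X.measurable_w.aemeasurable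
  have h1 : ∫⁻ ω, ENNReal.ofReal (Real.exp (-(s * X.interferenceGain ω))) ∂P =
      ∫⁻ q, ENNReal.ofReal (Real.exp (-(s * ‖q.1 ⬝ᵥ q.2‖ ^ 2)))
        ∂(P.map fun ω => (X.f₁ ω, X.w ω)) := by
    rw [lintegral_map hF (X.measurable_f₁.prodMk X.measurable_w)]
    rfl
  -- The integral over `f₁` is taken first with `w` frozen: for a unit vector `w`, the scalar `f₁ᵀw`
  -- has law `CN(0, qr)` whatever `w` is.
  rw [h1, hmap, lintegral_prod_symm' _ hF]
  have h2 : ∀ᵐ w ∂P.map X.w,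
      ∫⁻ f, ENNReal.ofReal (Real.exp (-(s * ‖f ⬝ᵥ w‖ ^ 2))) ∂P.map X.f₁ =
        ENNReal.ofReal (1 + s * p.qr)⁻¹ := by
    have h3 : ∀ᵐ w ∂P.map X.w, ∑ i, ‖w i‖ ^ 2 = 1 :=
      (ae_map_iff X.measurable_w.aemeasurable
        (measurableSet_eq_fun (by fun_prop) (by fun_prop))).2 X.ae_sum_norm_sq_w
    filter_upwards [h3] with w hw
    have hd : Measurable fun f : Fin p.NT → ℂ => f ⬝ᵥ w := by
      unfold dotProduct
      fun_prop
    rw [← lintegral_exp_neg_mul_norm_sq_complexGaussian p.qr_nonneg hs]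
    conv_rhs => rw [← mul_one p.qr, ← hw, ← map_dotProduct_complexGaussian p.qr_nonneg w]
    rw [X.law_f₁, lintegral_map (by fun_prop) hd]
  rw [lintegral_congr_ae h2]
  simp

/-- Probability that a Rayleigh fading signal exceeds noise plus interference. -/
theorem measure_lt_norm_h₁_sq {a b : ℝ} (ha : 0 ≤ a) (hb : 0 ≤ b) :
    P {ω | a * (1 + b * X.interferenceGain ω) < ‖X.h₁ ω‖ ^ 2} =
      ENNReal.ofReal (Real.exp (-a) / (1 + a * b * p.qr)) := by
  have hmap := (indepFun_iff_map_prod_eq_prod_map_map X.measurable_interferenceGain.aemeasurable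
    X.measurable_h₁.aemeasurable).1 X.indepFun_interferenceGain_h₁
  have hs : MeasurableSet {q : ℝ × ℂ | a * (1 + b * q.1) < ‖q.2‖ ^ 2} :=
    measurableSet_lt (by fun_prop) (by fun_prop)
  have h1 : P {ω | a * (1 + b * X.interferenceGain ω) < ‖X.h₁ ω‖ ^ 2} =
      (P.map fun ω => (X.interferenceGain ω, X.h₁ ω))
        {q : ℝ × ℂ | a * (1 + b * q.1) < ‖q.2‖ ^ 2} := by
    rw [Measure.map_apply (X.measurable_interferenceGain.prodMk X.measurable_h₁) hs]
    rfl
  rw [h1, hmap, X.law_h₁, Measure.prod_apply hs,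
    lintegral_map (measurable_measure_prodMk_left hs) X.measurable_interferenceGain]
  -- Given the gain, the exponential tail splits into a constant factor and the integrand of the
  -- Laplace transform at `a * b`.
  have h2 : ∀ ω, complexGaussian 1 (Prod.mk (X.interferenceGain ω) ⁻¹'
      {q : ℝ × ℂ | a * (1 + b * q.1) < ‖q.2‖ ^ 2}) =
      ENNReal.ofReal (Real.exp (-a)) *
        ENNReal.ofReal (Real.exp (-(a * b * X.interferenceGain ω))) := by
    intro ω
    have h0 : 0 ≤ X.interferenceGain ω := sq_nonneg _
    rw [← ENNReal.ofReal_mul (by positivity), ← Real.exp_add]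
    refine (complexGaussian_one_norm_sq_gt (t := a * (1 + b * X.interferenceGain ω))
      (by positivity)).trans ?_
    congr 2
    ring
  simp_rw [h2]
  have hg := X.measurable_interferenceGain
  rw [lintegral_const_mul _ (by fun_prop),
    X.lintegral_exp_neg_interferenceGain (mul_nonneg ha hb),
    ← ENNReal.ofReal_mul (by positivity), div_eq_mul_inv]

end NNNFNetwork

/-! ### Outage integral and decoding threshold -/

namespace NomaParams

variable (p : NomaParams)

theorem measurable_outageAt (η : ℝ) : Measurable (p.outageAt η) := by
  unfold outageAt
  fun_prop

/-- Probability that the disc contains a near user. -/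
def nearProb : ℝ := 1 - Real.exp (-(Real.pi * p.lamN * p.R₁ ^ 2))

theorem nearProb_pos : 0 < p.nearProb := by
  have h1 := p.lamN_pos
  have h2 := p.R₁_pos
  have h3 := Real.pi_pos
  rw [nearProb, sub_pos, Real.exp_lt_one_iff, neg_lt_zero]
  positivity

/-- Probability that the disc contains a near user and that the nearest one decodes both symbols,
with the cosine of the angle between this user and the relay set to `η`. -/
def successIntegral (η : ℝ) : ℝ :=
  ∫ r in (0 : ℝ)..p.R₁,
    2 * Real.pi * p.lamN * (r * Real.exp (-(Real.pi * p.lamN * r ^ 2))) * (1 - p.outageAt η r)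

theorem successIntegrand_nonneg {η r : ℝ} (hη : η ≤ 1) (hr : 0 ≤ r) :
    0 ≤ 2 * Real.pi * p.lamN * (r * Real.exp (-(Real.pi * p.lamN * r ^ 2))) *
      (1 - p.outageAt η r) := by
  have h1 := p.lamN_pos
  have h2 := Real.pi_pos
  exact mul_nonneg (by positivity) (sub_nonneg.2 (p.outageAt_mem_Icc hη hr).2)

theorem successIntegral_nonneg {η : ℝ} (hη : η ≤ 1) : 0 ≤ p.successIntegral η :=
  intervalIntegral.integral_nonneg p.R₁_pos.le fun _ hr => p.successIntegrand_nonneg hη hr.1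

theorem intervalIntegrable_mul_outageAt {η : ℝ} (hη : η ≤ 1) {f : ℝ → ℝ} (hf : Continuous f) :
    IntervalIntegrable (fun r => f r * p.outageAt η r) volume 0 p.R₁ := by
  have h0 := hf.intervalIntegrable (μ := volume) 0 p.R₁
  refine h0.mono_fun (hf.measurable.mul (p.measurable_outageAt η)).aestronglyMeasurable ?_
  refine (ae_restrict_iff' measurableSet_uIoc).2 (.of_forall fun r hr => ?_)
  rw [Set.uIoc_of_le p.R₁_pos.le] at hr
  have h1 := p.outageAt_mem_Icc hη hr.1.le
  simp only [norm_mul]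
  refine mul_le_of_le_one_right (norm_nonneg _) ?_
  rw [Real.norm_of_nonneg h1.1]
  exact h1.2

theorem integral_rayleigh_density :
    ∫ r in (0 : ℝ)..p.R₁, 2 * Real.pi * p.lamN * (r * Real.exp (-(Real.pi * p.lamN * r ^ 2))) =
      p.nearProb := by
  rw [intervalIntegral.integral_eq_sub_of_hasDerivAt
    (fun x _ => hasDerivAt_neg_exp_neg_mul_sq p.lamN x)
    (Continuous.intervalIntegrable (by fun_prop) _ _), nearProb]
  simp
  ring

/-- The constant `υn` is the Rayleigh prefactor divided by `nearProb`, so the density conditioned on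
a nonempty disc has mass one and outage and success are complementary. -/
theorem outageBound_eq {η : ℝ} (hη : η ≤ 1) :
    p.outageBound η = 1 - p.nearProb⁻¹ * p.successIntegral η := by
  have hE := p.nearProb_pos
  have h1 : p.successIntegral η = p.nearProb -
      ∫ r in (0 : ℝ)..p.R₁, 2 * Real.pi * p.lamN *
        (r * Real.exp (-(Real.pi * p.lamN * r ^ 2))) * p.outageAt η r := by
    rw [successIntegral, ← p.integral_rayleigh_density, ← intervalIntegral.integral_sub
      (Continuous.intervalIntegrable (by fun_prop) _ _)
      (p.intervalIntegrable_mul_outageAt hη (by fun_prop))]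
    simp only [mul_sub, mul_one]
  simp_rw [mul_assoc (2 * Real.pi * p.lamN)] at h1
  rw [intervalIntegral.integral_const_mul] at h1
  rw [h1, outageBound, υn, ← nearProb]
  field_simp
  ring

/-- Decoding both symbols amounts to a single threshold on the received signal power `x`. -/
theorem decoding_iff (hτ : p.τ₂ < p.a₂ / p.a₁) {x I : ℝ} (hx : 0 ≤ x) (hI : 0 ≤ I) :
    (p.ρs * p.a₂ * x / (p.ρs * p.a₁ * x + I + 1) > p.τ₂ ∧
      p.ρs * p.a₁ * x / (I + 1) > p.τ₁) ↔ p.μ * (1 + I) < x := by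
  have hρ := p.ρs_pos
  have ha := p.a₁_pos
  have hτ₂ := p.τ₂_pos
  rw [lt_div_iff₀ ha] at hτ
  -- This positivity is what `τ₂ < a₂ / a₁` provides: the condition on the far user's symbol can be
  -- solved for `x` without reversing the inequality.
  have hs : 0 < p.ρs * p.a₂ - p.ρs * p.a₁ * p.τ₂ := by nlinarith
  have hζ : 1 / p.ζ = p.τ₂ / (p.ρs * p.a₂ - p.ρs * p.a₁ * p.τ₂) := by rw [ζ, one_div_div]
  rw [gt_iff_lt, gt_iff_lt, lt_div_iff₀ (by positivity), lt_div_iff₀ (by positivity), μ,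
    max_mul_of_nonneg _ _ (by positivity), max_lt_iff, hζ, div_mul_eq_mul_div,
    div_mul_eq_mul_div, div_lt_iff₀ hs, div_lt_iff₀ (by positivity)]
  constructor <;> rintro ⟨h1, h2⟩ <;> constructor <;> linarith

end NomaParams

/-! ### Sandwiching the success event -/

namespace NNNFNetwork

variable {Ω : Type*} [MeasurableSpace Ω] {p : NomaParams} {P : Measure Ω}
  (X : NNNFNetwork p P)

/-- The disc contains a near user and the nearest one decodes both symbols, with the cosine of the
angle between this user and the relay set to `η`. -/
def successAt (η : ℝ) : Set Ω :=
  {ω | X.nearDist ω ≤ p.R₁ ∧ p.μ * X.nearDist ω ^ p.α *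
    (1 + p.ρr * (p.R₁ ^ 2 + X.nearDist ω ^ 2 - 2 * η * p.R₁ * X.nearDist ω) ^ (-p.α / 2) *
      X.interferenceGain ω) < ‖X.h₁ ω‖ ^ 2}

theorem measure_successAt [IsProbabilityMeasure P] {η : ℝ} (hη : η ≤ 1) :
    P (X.successAt η) = ENNReal.ofReal (p.successIntegral η) := by
  have hY := X.measurable_interferenceGain.prodMk X.measurable_h₁
  have hmap := (indepFun_iff_map_prod_eq_prod_map_map X.measurable_nearDist.aemeasurable
    hY.aemeasurable).1 X.indepFun_nearDist_interferenceGain_h₁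
  set S : Set (ℝ × ℝ × ℂ) := {q | p.μ * q.1 ^ p.α *
    (1 + p.ρr * (p.R₁ ^ 2 + q.1 ^ 2 - 2 * η * p.R₁ * q.1) ^ (-p.α / 2) * q.2.1) <
      ‖q.2.2‖ ^ 2} with hS
  have hSm : MeasurableSet S := measurableSet_lt (by fun_prop) (by fun_prop)
  have hIm : MeasurableSet ((Set.Iic p.R₁ : Set ℝ) ×ˢ (Set.univ : Set (ℝ × ℂ))) :=
    measurableSet_Iic.prod .univ
  have := Measure.isProbabilityMeasure_map (μ := P) X.measurable_nearDist.aemeasurable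
  have := Measure.isProbabilityMeasure_map (μ := P) hY.aemeasurable
  -- Restricting the distance to `Iic R₁` removes the default value `R₁ + 1` and so encodes the
  -- presence of a near user.
  have h1 : P (X.successAt η) = (((P.map X.nearDist).restrict (Set.Iic p.R₁)).prod
      (P.map fun ω => (X.interferenceGain ω, X.h₁ ω))) S := by
    rw [← Measure.restrict_univ (μ := P.map fun ω => (X.interferenceGain ω, X.h₁ ω)),
      Measure.prod_restrict, ← hmap, Measure.restrict_apply hSm,
      Measure.map_apply (X.measurable_nearDist.prodMk hY) (hSm.inter hIm)]
    congr 1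
    ext ω
    simp [successAt, hS, and_comm]
  have h2 : ∀ r ∈ Set.Ioc 0 p.R₁,
      (P.map fun ω => (X.interferenceGain ω, X.h₁ ω)) (Prod.mk r ⁻¹' S) =
        ENNReal.ofReal (1 - p.outageAt η r) := by
    intro r hr
    rw [Measure.map_apply hY (measurable_prodMk_left hSm)]
    have hμ := p.μ_pos
    have hρ := p.ρr_pos
    have hr0 := hr.1.le
    have hD := (sq_nonneg _).trans (p.sq_sub_le_cosine_law hη hr0)
    refine (X.measure_lt_norm_h₁_sq (a := p.μ * r ^ p.α)
      (b := p.ρr * (p.R₁ ^ 2 + r ^ 2 - 2 * η * p.R₁ * r) ^ (-p.α / 2))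
      (by positivity) (by positivity)).trans ?_
    rw [NomaParams.outageAt, sub_sub_cancel]
    congr 3
    ring
  rw [h1, Measure.prod_apply hSm, X.map_nearDist_restrict,
    lintegral_withDensity_eq_lintegral_mul _ (by fun_prop) (measurable_measure_prodMk_left hSm)]
  rw [NomaParams.successIntegral, intervalIntegral.integral_of_le p.R₁_pos.le,
    ofReal_integral_eq_lintegral_ofReal]
  · refine setLIntegral_congr_fun measurableSet_Ioc fun r hr => ?_
    have hl := p.lamN_pos
    have hpi := Real.pi_pos
    have hr0 := hr.1.le
    simp only [Pi.mul_apply]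
    rw [h2 r hr, ← ENNReal.ofReal_mul (by positivity)]
  · rw [← IntegrableOn, ← intervalIntegrable_iff_integrableOn_Ioc_of_le p.R₁_pos.le]
    simp only [mul_sub, mul_one]
    exact (Continuous.intervalIntegrable (by fun_prop) _ _).sub
      (p.intervalIntegrable_mul_outageAt hη (by fun_prop))
  · exact (ae_restrict_iff' measurableSet_Ioc).2
      (.of_forall fun r hr => p.successIntegrand_nonneg hη hr.1.le)

/-- A law with a density charges neither endpoint. At `0` the path loss is degenerate, and at `R₁`
the user could coincide with the relay. -/
theorem ae_nearDist_mem_Ioo [IsProbabilityMeasure P] :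
    ∀ᵐ ω ∂P, X.nearDist ω ≤ p.R₁ → X.nearDist ω ∈ Set.Ioo 0 p.R₁ := by
  refine ae_of_ae_map X.measurable_nearDist.aemeasurable
    (p := fun r => r ≤ p.R₁ → r ∈ Set.Ioo 0 p.R₁) ?_
  refine (ae_restrict_iff' (measurableSet_Iic (a := p.R₁))).1 ?_
  rw [X.map_nearDist_restrict, ← restrict_Ioo_eq_restrict_Ioc]
  exact (withDensity_absolutelyContinuous _ _).ae_le (ae_restrict_mem measurableSet_Ioo)

theorem interferenceGain_nonneg (ω : Ω) : 0 ≤ X.interferenceGain ω := sq_nonneg _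

theorem interference_nonneg (ω : Ω) : 0 ≤ X.interference ω := by
  have := p.ρr_pos
  have : 0 ≤ X.distR ω := norm_nonneg _
  unfold interference
  positivity

theorem norm_relayPos (k : Fin p.K) : ‖p.relayPos k‖ = p.R₁ := by
  rw [NomaParams.relayPos, norm_mul, Complex.norm_exp_ofReal_mul_I, mul_one, Complex.norm_real,
    Real.norm_of_nonneg p.R₁_pos.le]

theorem interference_eq (ω : Ω) :
    X.interference ω = p.ρr * (X.distR ω ^ 2) ^ (-p.α / 2) * X.interferenceGain ω := by
  have h0 : 0 ≤ X.distR ω := norm_nonneg _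
  rw [interference, interferenceGain, ← Real.rpow_natCast (X.distR ω) 2, ← Real.rpow_mul h0]
  congr 3
  push_cast
  ring

theorem nearDist_of_nonempty {ω : Ω} (h : (X.Φn ω).Nonempty) : X.nearDist ω = X.dist₁ ω := by
  rw [nearDist, if_pos h, dist₁]

theorem decoding_iff_lt (hτ : p.τ₂ < p.a₂ / p.a₁) {ω : Ω} (h : 0 < X.dist₁ ω) :
    (X.sinr₂ ω > p.τ₂ ∧ X.sinr₁ ω > p.τ₁) ↔
      p.μ * X.dist₁ ω ^ p.α * (1 + X.interference ω) < ‖X.h₁ ω‖ ^ 2 := by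
  have hd : 0 < X.dist₁ ω ^ p.α := by positivity
  have hx : 0 ≤ X.dist₁ ω ^ (-p.α) * ‖X.h₁ ω‖ ^ 2 := by positivity
  have key := p.decoding_iff hτ hx (X.interference_nonneg ω)
  rw [sinr₂, sinr₁, mul_assoc (p.ρs * p.a₂), mul_assoc (p.ρs * p.a₁), key,
    Real.rpow_neg h.le, ← div_eq_inv_mul, lt_div_iff₀ hd, mul_right_comm]

/-- The interference lies between its values at the two extreme relay positions. -/
theorem interference_bounds {ω : Ω} (h : X.dist₁ ω ∈ Set.Ioo 0 p.R₁) :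
    p.ρr * (p.R₁ ^ 2 + X.dist₁ ω ^ 2 - 2 * (-1) * p.R₁ * X.dist₁ ω) ^ (-p.α / 2) *
        X.interferenceGain ω ≤ X.interference ω ∧
      X.interference ω ≤
        p.ρr * (p.R₁ ^ 2 + X.dist₁ ω ^ 2 - 2 * 1 * p.R₁ * X.dist₁ ω) ^ (-p.α / 2) *
          X.interferenceGain ω := by
  have hρ := p.ρr_pos
  have hα := p.α_pos
  have hg := X.interferenceGain_nonneg ω
  -- The triangle inequality replaces the angle: it uses only that every relay has norm `R₁`, so the
  -- bounds hold whichever relay is selected.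
  have h1 : p.R₁ - X.dist₁ ω ≤ X.distR ω := by
    have := norm_sub_norm_le (p.relayPos (X.κ ω)) (X.U₁ ω)
    rwa [norm_relayPos] at this
  have h2 : X.distR ω ≤ p.R₁ + X.dist₁ ω := by
    have := norm_sub_le (p.relayPos (X.κ ω)) (X.U₁ ω)
    rwa [norm_relayPos] at this
  have h3 := sub_pos.2 h.2
  have h4 : 0 < X.distR ω := h3.trans_le h1
  have h5 : p.R₁ ^ 2 + X.dist₁ ω ^ 2 - 2 * 1 * p.R₁ * X.dist₁ ω = (p.R₁ - X.dist₁ ω) ^ 2 := by ring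
  have h6 : p.R₁ ^ 2 + X.dist₁ ω ^ 2 - 2 * (-1) * p.R₁ * X.dist₁ ω = (p.R₁ + X.dist₁ ω) ^ 2 := by
    ring
  rw [h5, h6, interference_eq]
  have hα' : -p.α / 2 ≤ 0 := by linarith
  constructor <;> refine mul_le_mul_of_nonneg_right (mul_le_mul_of_nonneg_left ?_ hρ.le) hg
  · exact Real.rpow_le_rpow_of_nonpos (by positivity) (by gcongr) hα'
  · exact Real.rpow_le_rpow_of_nonpos (by positivity) (by gcongr) hα'

/-- Both symbols are decoded by the selected near user. -/
def success : Set Ω := {ω | X.sinr₂ ω > p.τ₂ ∧ X.sinr₁ ω > p.τ₁}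

/-- The decoding threshold increases with the interference, so the largest interference (`η = 1`)
gives the smaller event and the least (`η = -1`) the larger one. -/
theorem ae_success_sandwich [IsProbabilityMeasure P] (hτ : p.τ₂ < p.a₂ / p.a₁) :
    ∀ᵐ ω ∂P, (ω ∈ X.successAt 1 → ω ∈ {ω | (X.Φn ω).Nonempty} ∩ X.success) ∧
      (ω ∈ {ω | (X.Φn ω).Nonempty} ∩ X.success → ω ∈ X.successAt (-1)) := by
  filter_upwards [X.ae_nearDist_mem_Ioo] with ω hω
  have hμ := p.μ_pos
  constructor
  · rintro ⟨h1, h2⟩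
    have hne := (X.nearDist_le_R₁_iff ω).1 h1
    have hmem := hω h1
    rw [X.nearDist_of_nonempty hne] at hmem h2
    refine ⟨hne, (X.decoding_iff_lt hτ hmem.1).2 (lt_of_le_of_lt ?_ h2)⟩
    have h0 := hmem.1
    gcongr
    exact (X.interference_bounds hmem).2
  · rintro ⟨hne, hs⟩
    have h1 := (X.nearDist_le_R₁_iff ω).2 hne
    have hmem := hω h1
    refine ⟨h1, ?_⟩
    rw [X.nearDist_of_nonempty hne] at hmem ⊢
    refine lt_of_le_of_lt ?_ ((X.decoding_iff_lt hτ hmem.1).1 hs)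
    have h0 := hmem.1
    gcongr
    exact (X.interference_bounds hmem).1

theorem setOf_nonempty_eq : {ω | (X.Φn ω).Nonempty} = {ω | X.nearDist ω ≤ p.R₁} := by
  ext ω
  exact (X.nearDist_le_R₁_iff ω).symm

theorem nearOutage_eq [IsProbabilityMeasure P] :
    X.nearOutage = 1 - p.nearProb⁻¹ * P.real ({ω | (X.Φn ω).Nonempty} ∩ X.success) := by
  have hm : MeasurableSet {ω | (X.Φn ω).Nonempty} := by
    rw [X.setOf_nonempty_eq]
    exact X.measurable_nearDist measurableSet_Iic
  have hN : P {ω | (X.Φn ω).Nonempty} = ENNReal.ofReal p.nearProb := by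
    rw [X.setOf_nonempty_eq, X.measure_nearDist_le le_rfl, max_eq_left p.R₁_pos.le,
      NomaParams.nearProb]
  rw [nearOutage, Measure.real, cond_apply hm, ENNReal.toReal_mul, ENNReal.toReal_inv, hN,
    ENNReal.toReal_ofReal p.nearProb_pos.le]
  rfl

/-- Here `a₂ x ≤ τ₂ a₁ x`: the near user's superposed signal alone already keeps the SINR of the far
user's symbol from exceeding `τ₂`, however strong the channel. -/
theorem success_eq_empty (hτ : p.a₂ / p.a₁ ≤ p.τ₂) : X.success = ∅ := by
  refine Set.eq_empty_of_forall_notMem fun ω hω => ?_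
  have hρ := p.ρs_pos
  have ha := p.a₁_pos
  have hI := X.interference_nonneg ω
  have hx : 0 ≤ X.dist₁ ω ^ (-p.α) * ‖X.h₁ ω‖ ^ 2 := by
    have : 0 ≤ X.dist₁ ω := norm_nonneg _
    positivity
  have h1 : X.sinr₂ ω > p.τ₂ := hω.1
  rw [sinr₂, mul_assoc (p.ρs * p.a₂), mul_assoc (p.ρs * p.a₁), gt_iff_lt,
    lt_div_iff₀ (by positivity)] at h1
  rw [div_le_iff₀ ha] at hτ
  have h2 := mul_le_mul_of_nonneg_left hτ (mul_nonneg hρ.le hx)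
  have h3 := mul_nonneg p.τ₂_pos.le (add_nonneg hI zero_le_one)
  nlinarith

end NNNFNetwork

end

theorem corollary3 {Ω : Type*} [MeasurableSpace Ω] (P : Measure Ω) [IsProbabilityMeasure P]
    (p : NomaParams) (X : NNNFNetwork p P) :
    (p.τ₂ < p.a₂ / p.a₁ →
      X.nearOutage ≤ p.outageBound 1 ∧
      p.outageBound (-1) ≤ X.nearOutage ∧
      ∀ η : ℝ, η = 1 ∨ η = -1 →
        Filter.Tendsto (fun M : ℕ => p.chebyshevSum η M) Filter.atTop
          (nhds (p.outageBound η))) ∧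
    (p.a₂ / p.a₁ ≤ p.τ₂ → X.nearOutage = 1) := by
  refine ⟨fun hτ => ⟨?_, ?_, ?_⟩, fun hτ => ?_⟩
  · have h : P (X.successAt 1) ≤ P ({ω | (X.Φn ω).Nonempty} ∩ X.success) :=
      -- Monotonicity holds for arbitrary sets, so measurability of the success event is not needed.
      measure_mono_ae ((X.ae_success_sandwich hτ).mono fun ω hω => hω.1)
    rw [X.measure_successAt le_rfl,
      ENNReal.ofReal_le_iff_le_toReal (measure_ne_top _ _)] at h
    rw [X.nearOutage_eq, p.outageBound_eq le_rfl]
    have := inv_nonneg.2 p.nearProb_pos.le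
    gcongr
    exact h
  · have h : P ({ω | (X.Φn ω).Nonempty} ∩ X.success) ≤ P (X.successAt (-1)) :=
      measure_mono_ae ((X.ae_success_sandwich hτ).mono fun ω hω => hω.2)
    rw [X.measure_successAt (by norm_num)] at h
    rw [X.nearOutage_eq, p.outageBound_eq (by norm_num)]
    have := inv_nonneg.2 p.nearProb_pos.le
    gcongr
    exact ENNReal.toReal_le_of_le_ofReal (p.successIntegral_nonneg (by norm_num)) h
  · rintro η (rfl | rfl)
    · exact p.tendsto_chebyshevSum le_rfl
    · exact p.tendsto_chebyshevSum (by norm_num)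
  · rw [X.nearOutage_eq, X.success_eq_empty hτ]
    simp
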